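/- **Theorem.** For a hexagonal system $H$ (a plane graph formed by finitely many cells of the regular hexagonal tiling), a *Clar cover* of $H$ is a spanning subgraph of $H$ each connected component of which is a hexagon or an edge, a *resonant pattern* is the set of hexagons of a Clar cover, and $s(H,k)$ is the number of resonant patterns having precisely $k$ hexagons. For $n\ge 0$ let $P_n$ be the pyrene chain: it has $4n$ hexagons, consisting of a straight row $c_0,c_1,\dots,c_{2n-1}$ of consecutively adjacent hexagons together with, for each $0\le i<n$, the two further hexagons (one above and one below the row) adjacent to both $c_{2i}$ and $c_{2i+1}$ ($P_0$ is empty, with $s(P_0,0)=1$). Put $$p(n,k)=\frac{s(P_n,k)}{\sum_j s(P_n,j)}\quad(k\ge 0),\qquad p(n,k)=0\quad (k<0),$$ and let $\mu_n=\sum_k k\,p(n,k)$ and $\sigma_n^2=\sum_k (k-\mu_n)^2p(n,k)$, $\sigma_n\ge 0$, be the mean and the variance. Then the numbers $s(P_n,k)$ are asymptotically normal by a central limit theorem, $$\lim_{n\to\infty}\sup_{x\in\mathbb R}\Bigl|\sum_{k\le \mu_n+x\sigma_n}p(n,k)-\frac1{\sqrt{2\pi}}\int_{-\infty}^x e^{-t^2/2}\,dt\Bigr|=0,$$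 and by a local limit theorem on $\mathbb R$, $$\lim_{n\to\infty}\sup_{x\in\mathbb R}\Bigl|\sigma_n\,p(n,\lfloor\mu_n+x\sigma_n\rfloor)-\frac1{\sqrt{2\pi}}e^{-x^2/2}\Bigr|=0.$$ Moreover, for every $n\ge 0$, $$\mu_n=n,\qquad \sigma_n^2=\frac12\sum_{k=1}^n\frac1{1+\cos^2\frac{k\pi}{2n+2}},$$ and $\sigma_n^2\sim\frac{\sqrt2}{4}\,n$ as $n\to\infty$. -/

import Mathlib

open Filter Topology

noncomputable section

namespace Sextet

/-! ## Hexagonal systems, Clar covers, resonant patterns -/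

/-- The hexagonal (honeycomb) lattice graph in brick-wall coordinates: every `(x, y)` is joined to
`(x + 1, y)`, and `(x, y)` is joined to `(x, y + 1)` when `x + y` is even. Placing `(x, y)` at the
point `(√3 x / 2, 3 y / 2 + ε / 4)` of the plane, with `ε = 1` if `x + y` is even and `ε = -1`
otherwise, gives the tiling of the plane by regular hexagons of side length `1`. -/
def hexLattice : SimpleGraph (ℤ × ℤ) :=
  SimpleGraph.fromRel fun u v =>
    v = (u.1 + 1, u.2) ∨ (Even (u.1 + u.2) ∧ v = (u.1, u.2 + 1))

/-- The six corners of the hexagonal cell with axial coordinates `(i, j)`. The cells of the lattice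
are indexed bijectively by `ℤ × ℤ`; the cell `(i, j)` shares a side exactly with the cells
`(i ± 1, j)`, `(i, j ± 1)`, `(i + 1, j - 1)` and `(i - 1, j + 1)`. -/
def corners (h : ℤ × ℤ) : Set (ℤ × ℤ) :=
  {v | 2 * h.1 + h.2 ≤ v.1 ∧ v.1 ≤ 2 * h.1 + h.2 + 2 ∧ h.2 ≤ v.2 ∧ v.2 ≤ h.2 + 1}

/-- The hexagon (a 6-cycle) bounding a cell, as a subgraph of the lattice. -/
def hexagon (h : ℤ × ℤ) : hexLattice.Subgraph :=
  (⊤ : hexLattice.Subgraph).induce (corners h)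

/-- The plane graph formed by a finite set `H` of hexagonal cells: all their corners and sides. -/
def hexGraph (H : Finset (ℤ × ℤ)) : hexLattice.Subgraph :=
  ⨆ h ∈ H, hexagon h

/-- `D` is a connected component of `C`: a maximal connected subgraph of `C`. -/
def IsComponent (D C : hexLattice.Subgraph) : Prop :=
  Maximal (fun D' : hexLattice.Subgraph => D' ≤ C ∧ D'.Connected) D

/-- A Clar cover of `H`: a spanning subgraph each component of which is a hexagon or an edge. -/
def IsClarCover (H : Finset (ℤ × ℤ)) (C : hexLattice.Subgraph) : Prop :=
  C ≤ hexGraph H ∧ C.verts = (hexGraph H).verts ∧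
    ∀ D : hexLattice.Subgraph, IsComponent D C →
      (∃ h ∈ H, D = hexagon h) ∨
        (∃ (u v : ℤ × ℤ) (e : hexLattice.Adj u v), D = hexLattice.subgraphOfAdj e)

/-- A resonant pattern of `H`: the set of all hexagons of some Clar cover of `H`. -/
def IsResonantPattern (H S : Finset (ℤ × ℤ)) : Prop :=
  ∃ C : hexLattice.Subgraph, IsClarCover H C ∧
    ∀ h : ℤ × ℤ, h ∈ S ↔ h ∈ H ∧ IsComponent (hexagon h) C

/-- `s(H, k)`: the number of resonant patterns of `H` having precisely `k` hexagons. -/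
def resonantNumber (H : Finset (ℤ × ℤ)) (k : ℕ) : ℕ :=
  {S : Finset (ℤ × ℤ) | IsResonantPattern H S ∧ S.card = k}.ncard

/-- The pyrene chain `P_n`. The `i`-th pyrene consists of two cells `(2i, 0)`, `(2i + 1, 0)` sharing
a side, and the cells `(2i, 1)`, `(2i + 1, -1)` above and below that side, each adjacent to both;
the cell `(2i + 1, 0)` shares a side with the cell `(2i + 2, 0)` of the next pyrene. -/
def pyreneChain (n : ℕ) : Finset (ℤ × ℤ) :=
  (Finset.range n).biUnion fun i =>
    {(2 * (i : ℤ), 0), (2 * (i : ℤ) + 1, 0), (2 * (i : ℤ), 1), (2 * (i : ℤ) + 1, -1)}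

/-! ## Asymptotic normality of a double sequence -/

/-- `p(n, m) = a(n, m) / ∑ j, a(n, j)`, with value `0` at negative integers `m`. -/
def normalizedProb (a : ℕ → ℕ → ℝ) (n : ℕ) (m : ℤ) : ℝ :=
  if 0 ≤ m then a n m.toNat / ∑' j : ℕ, a n j else 0

/-- The mean `μ_n` of the probabilities `p(n, ·)`. -/
def seqMean (a : ℕ → ℕ → ℝ) (n : ℕ) : ℝ :=
  ∑' k : ℕ, (k : ℝ) * normalizedProb a n k

/-- The variance `σ_n²` of the probabilities `p(n, ·)`. -/
def seqVariance (a : ℕ → ℕ → ℝ) (n : ℕ) : ℝ :=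
  ∑' k : ℕ, ((k : ℝ) - seqMean a n) ^ 2 * normalizedProb a n k

/-- The standard deviation `σ_n`. -/
def seqStdDev (a : ℕ → ℕ → ℝ) (n : ℕ) : ℝ := √(seqVariance a n)

open Classical in
/-- Asymptotic normality by a central limit theorem. -/
def AsymptoticallyNormalCLT (a : ℕ → ℕ → ℝ) : Prop :=
  Tendsto
    (fun n : ℕ => ⨆ x : ℝ, ENNReal.ofReal
      |(∑' k : ℕ, if (k : ℝ) ≤ seqMean a n + x * seqStdDev a n then normalizedProb a n k else 0)
        - 1 / √(2 * Real.pi) * ∫ t in Set.Iic x, Real.exp (-t ^ 2 / 2)|)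
    atTop (𝓝 0)

/-- Asymptotic normality by a local limit theorem on `ℝ`. -/
def AsymptoticallyNormalLLT (a : ℕ → ℕ → ℝ) : Prop :=
  Tendsto
    (fun n : ℕ => ⨆ x : ℝ, ENNReal.ofReal
      |seqStdDev a n * normalizedProb a n ⌊seqMean a n + x * seqStdDev a n⌋
        - 1 / √(2 * Real.pi) * Real.exp (-x ^ 2 / 2)|)
    atTop (𝓝 0)

/-- The resonant sextet numbers `s(P_n, k)` of the pyrene chains, as real numbers. -/
def pyreneNumber (n k : ℕ) : ℝ := (resonantNumber (pyreneChain n) k : ℝ)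

end Sextet

end

/-!
The proof has a combinatorial and an analytic half.

*Resonant patterns are independent sets.* Hexagons of a Clar cover are components, so those of a
resonant pattern are pairwise disjoint. For a pyrene chain the converse holds
(`isResonantPattern_pyreneChain`): outside a set of pairwise disjoint hexagons, the vertices are
matched by an explicit involution (`partner`), which pairs the ends of each vertical side that
bounds a pyrene, and treats the interior of each pyrene separately.

*Sextet polynomial.* Removing the cells of the last pyrene one at a time gives
`F_{n+2} = (1 + 4x + x²) F_{n+1} - x² F_n` for the polynomial `F_n = ∑ k, s(P_n, k) x ^ k`. This is
the recurrence of the Chebyshev polynomials of the second kind in `(1 + 4x + x²) / (2x)`, whose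
roots are known, so `F_n` is the product of the palindromic quadratics
`x² + (4 - 2 cos (kπ / (n + 1))) x + 1`, for `1 ≤ k ≤ n` (`sextetPoly_eq_prod`). Hence `p(n, ·)` is
the law of a sum of `n` independent variables with values in `{0, 1, 2}`, the `k`-th with mean `1`
and variance `1 / (3 - cos (kπ / (n + 1)))`. This gives the mean and the variance. The variance is
also the logarithmic derivative of `U_n` at `3`, and the formula for `U_n'` together with the
Pell equation `T_{n+1}(3)² - 8 U_n(3)² = 1` places it within `1` of `√2 n / 4` (`abs_var_sub_le`).

*Limit theorems.* The characteristic function of the recentred distribution is the real product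
`chi n t = ∏ (1 - v_k (1 - cos t))`, where the `v_k` are the variances of the factors. By Fourier
inversion (`normalizedProb_eq_integral`), the error of the local limit theorem at a lattice point is
at most the `L¹` distance between the rescaled `chi n` and `exp (-u² / 2)`, which tends to zero by
dominated convergence. The central limit theorem follows by Scheffé's argument
(`tendsto_integral_abs_sub_gauss`): the step densities of the standardised distributions converge
pointwise to the normal density, hence in `L¹`.
-/

noncomputable section

namespace Sextet

/-! ### Clar covers and resonant patterns -/

/-- The condition `u ≠ v` in `SimpleGraph.fromRel` is automatic. -/
theorem hexLattice_adj {u v : ℤ × ℤ} : hexLattice.Adj u v ↔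
    (v = (u.1 + 1, u.2) ∨ (Even (u.1 + u.2) ∧ v = (u.1, u.2 + 1))) ∨
      (u = (v.1 + 1, v.2) ∨ (Even (v.1 + v.2) ∧ u = (v.1, v.2 + 1))) := by
  rw [hexLattice, SimpleGraph.fromRel_adj]
  refine and_iff_right_of_imp ?_
  rintro h rfl
  simp [Prod.ext_iff] at h

theorem corners_injective : Function.Injective corners := by
  rintro ⟨i, j⟩ ⟨k, l⟩ h
  have h1 : (2 * i + j, j) ∈ corners (k, l) := h ▸ by simp [corners]
  have h2 : (2 * k + l, l) ∈ corners (i, j) := h ▸ by simp [corners]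
  simp only [corners, Set.mem_ofPred_eq] at h1 h2
  ext <;> grind

theorem hexagon_verts (h : ℤ × ℤ) : (hexagon h).verts = corners h := rfl

theorem hexagon_adj {h u v : ℤ × ℤ} :
    (hexagon h).Adj u v ↔ u ∈ corners h ∧ v ∈ corners h ∧ hexLattice.Adj u v := by
  simp [hexagon]

theorem hexagon_injective : Function.Injective hexagon := fun a b h =>
  corners_injective (by rw [← hexagon_verts, h, hexagon_verts])

/-- Every corner can be reached from the lower left one, along the bottom row or the top row. -/
theorem hexagon_connected (h : ℤ × ℤ) : (hexagon h).Connected := by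
  obtain ⟨i, j⟩ := h
  have key : ∀ u v : (hexagon (i, j)).verts, hexLattice.Adj u v →
      (hexagon (i, j)).coe.Reachable u v := fun u v huv =>
    SimpleGraph.Adj.reachable (hexagon_adj.2 ⟨u.2, v.2, huv⟩)
  have mem : ∀ a b : ℤ, 0 ≤ a → a ≤ 2 → 0 ≤ b → b ≤ 1 →
      (2 * i + j + a, j + b) ∈ (hexagon (i, j)).verts := fun a b _ _ _ _ => by
    rw [hexagon_verts]; simp only [corners, Set.mem_ofPred_eq]; omega
  have e : Even (2 * i + j + j) := ⟨i + j, by ring⟩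
  let p (a b : ℤ) (h1 : 0 ≤ a) (h2 : a ≤ 2) (h3 : 0 ≤ b) (h4 : b ≤ 1) :
    (hexagon (i, j)).verts := ⟨(2 * i + j + a, j + b), mem a b h1 h2 h3 h4⟩
  let o := p 0 0 (by simp) (by simp) (by simp) (by simp)
  have r01 : (hexagon (i, j)).coe.Reachable o (p 0 1 (by simp) (by simp) (by simp) (by simp)) :=
    key _ _ (hexLattice_adj.2 (by simp [o, p, e]))
  have hor : ∀ b (h3 : 0 ≤ b) (h4 : b ≤ 1),
      (hexagon (i, j)).coe.Reachable o (p 0 b (by simp) (by simp) h3 h4) := by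
    intro b h3 h4
    obtain rfl | rfl : b = 0 ∨ b = 1 := by omega
    · exact SimpleGraph.Reachable.refl _
    · exact r01
  have hor1 : ∀ b (h3 : 0 ≤ b) (h4 : b ≤ 1),
      (hexagon (i, j)).coe.Reachable o (p 1 b (by simp) (by simp) h3 h4) := fun b h3 h4 =>
    (hor b h3 h4).trans (key _ _ (hexLattice_adj.2 (by simp [p])))
  have hor2 : ∀ b (h3 : 0 ≤ b) (h4 : b ≤ 1),
      (hexagon (i, j)).coe.Reachable o (p 2 b (by simp) (by simp) h3 h4) := fun b h3 h4 =>
    (hor1 b h3 h4).trans (key _ _ (hexLattice_adj.2 (by simp [p, add_assoc])))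
  have all : ∀ v, (hexagon (i, j)).coe.Reachable o v := by
    rintro ⟨⟨x, y⟩, hv⟩
    have hv' := hv
    simp only [hexagon_verts, corners, Set.mem_ofPred_eq] at hv'
    obtain ⟨a, rfl⟩ : ∃ a, x = 2 * i + j + a := ⟨x - (2 * i + j), by ring⟩
    obtain ⟨b, rfl⟩ : ∃ b, y = j + b := ⟨y - j, by ring⟩
    have h3 : 0 ≤ b := by omega
    have h4 : b ≤ 1 := by omega
    obtain rfl | rfl | rfl : a = 0 ∨ a = 1 ∨ a = 2 := by omega
    exacts [hor b h3 h4, hor1 b h3 h4, hor2 b h3 h4]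
  rw [SimpleGraph.Subgraph.connected_iff]
  exact ⟨⟨fun u v => (all u).symm.trans (all v)⟩, ⟨_, o.2⟩⟩

/-- The components of a union of vertex-disjoint connected subgraphs are these subgraphs. -/
theorem isComponent_sSup_iff {𝓕 : Set hexLattice.Subgraph} (hc : ∀ M ∈ 𝓕, M.Connected)
    (hd : ∀ M ∈ 𝓕, ∀ N ∈ 𝓕, ∀ v, v ∈ M.verts → v ∈ N.verts → M = N)
    {D : hexLattice.Subgraph} : IsComponent D (sSup 𝓕) ↔ D ∈ 𝓕 := by
  -- A connected subgraph of the union that meets a member of the family stays inside it.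
  have key : ∀ M ∈ 𝓕, ∀ D : hexLattice.Subgraph, D ≤ sSup 𝓕 → D.Connected →
      ∀ v, v ∈ M.verts → v ∈ D.verts → D ≤ M := by
    intro M hM D hD hDc v hvM hvD
    have adj : ∀ a b, a ∈ M.verts → D.Adj a b → M.Adj a b := by
      intro a b ha hab
      obtain ⟨N, hN, h⟩ := SimpleGraph.Subgraph.sSup_adj.1 (hD.2 hab)
      rwa [hd M hM N hN a ha h.fst_mem]
    have hwalk : ∀ (a b : D.verts), D.coe.Walk a b → (a : ℤ × ℤ) ∈ M.verts →
        (b : ℤ × ℤ) ∈ M.verts := by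
      intro a b w
      induction w with
      | nil => exact id
      | cons h _ ih => exact fun ha => ih (adj _ _ ha h).snd_mem
    have hverts : D.verts ⊆ M.verts := by
      intro w hw
      obtain ⟨p⟩ := hDc.coe.preconnected ⟨v, hvD⟩ ⟨w, hw⟩
      exact hwalk _ _ p hvM
    exact ⟨hverts, fun a b hab => adj a b (hverts hab.fst_mem) hab⟩
  constructor
  · rintro ⟨⟨hD, hDc⟩, hmax⟩
    obtain ⟨v, hv⟩ := hDc.nonempty
    have hv' := hD.1 hv
    simp only [SimpleGraph.Subgraph.verts_sSup, Set.mem_iUnion, exists_prop] at hv'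
    obtain ⟨M, hM, hvM⟩ := hv'
    have h1 := key M hM D hD hDc v hvM hv
    rwa [le_antisymm h1 (hmax ⟨le_sSup hM, hc M hM⟩ h1)]
  · intro hD
    refine ⟨⟨le_sSup hD, hc D hD⟩, fun D' hD' hle => ?_⟩
    obtain ⟨v, hv⟩ := (hc D hD).nonempty
    exact key D hD D' hD'.1 hD'.2 v hv (hle.1 hv)

/-- Two distinct components of a subgraph have no common vertex. -/
theorem IsComponent.eq_of_mem {C D E : hexLattice.Subgraph} (hD : IsComponent D C)
    (hE : IsComponent E C) {v : ℤ × ℤ} (hvD : v ∈ D.verts) (hvE : v ∈ E.verts) : D = E := by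
  have hc : (D ⊔ E).Connected :=
    SimpleGraph.Subgraph.connected_sup hD.1.2.preconnected hE.1.2.preconnected ⟨v, hvD, hvE⟩
  have hle : D ⊔ E ≤ C := sup_le hD.1.1 hE.1.1
  exact le_antisymm (le_sup_left.trans (hE.2 ⟨hle, hc⟩ le_sup_right))
    (le_sup_right.trans (hD.2 ⟨hle, hc⟩ le_sup_left))

theorem mem_hexGraph_verts {H : Finset (ℤ × ℤ)} {v : ℤ × ℤ} :
    v ∈ (hexGraph H).verts ↔ ∃ h ∈ H, v ∈ corners h := by
  simp [hexGraph, hexagon_verts]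

/-- If the vertices of `H` outside the disjoint hexagons of `S` are matched along sides of cells of
`H` by an involution `p`, then `S` is a resonant pattern. -/
theorem isResonantPattern_of_involution {H S : Finset (ℤ × ℤ)} (hSH : S ⊆ H)
    (hS : ∀ h ∈ S, ∀ h' ∈ S, ∀ v, v ∈ corners h → v ∈ corners h' → h = h')
    (p : ℤ × ℤ → ℤ × ℤ)
    (hp : ∀ v, (∃ h ∈ H, v ∈ corners h) → (∀ h ∈ S, v ∉ corners h) →
      (∀ h ∈ S, p v ∉ corners h) ∧ p (p v) = v ∧ hexLattice.Adj v (p v) ∧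
        ∃ h ∈ H, v ∈ corners h ∧ p v ∈ corners h) :
    IsResonantPattern H S := by
  -- The components of the Clar cover: the hexagons of `S`, and the edges `E` of the matching.
  let E : Set hexLattice.Subgraph := {M | ∃ (v : ℤ × ℤ) (e : hexLattice.Adj v (p v)),
    (∃ h ∈ H, v ∈ corners h) ∧ (∀ h ∈ S, v ∉ corners h) ∧ M = hexLattice.subgraphOfAdj e}
  let 𝓕 : Set hexLattice.Subgraph := hexagon '' S ∪ E
  have hc : ∀ M ∈ 𝓕, M.Connected := by
    rintro M (⟨h, -, rfl⟩ | ⟨v, e, -, -, rfl⟩)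
    · exact hexagon_connected h
    · exact SimpleGraph.Subgraph.subgraphOfAdj_connected e
  have hE : ∀ h ∈ S, ∀ M ∈ E, ∀ v, v ∈ corners h → v ∉ M.verts := by
    rintro h hh M ⟨w, e, h1, h2, rfl⟩ v hv hvM
    rcases hvM with rfl | rfl
    · exact h2 h hh hv
    · exact (hp w h1 h2).1 h hh hv
  have hd : ∀ M ∈ 𝓕, ∀ N ∈ 𝓕, ∀ v, v ∈ M.verts → v ∈ N.verts → M = N := by
    rintro M (⟨h, hh, rfl⟩ | hM) N (⟨h', hh', rfl⟩ | hN) v hvM hvN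
    · rw [hS h hh h' hh' v hvM hvN]
    · exact absurd hvN (hE h hh N hN v hvM)
    · exact absurd hvM (hE h' hh' M hM v hvN)
    · obtain ⟨a, e, ha, ha', rfl⟩ := hM
      obtain ⟨b, e', hb, hb', rfl⟩ := hN
      have pa := (hp a ha ha').2.1
      have pb := (hp b hb hb').2.1
      have : b = a ∨ b = p a := by
        rcases hvM with rfl | rfl <;> rcases hvN with h | h
        · exact Or.inl h.symm
        · right; rw [h, pb]
        · exact Or.inr h.symm
        · left; rw [← pa, ← pb, h]
      rcases this with rfl | rfl
      · rfl
      · ext <;> simp [pa, or_comm, Sym2.eq_swap]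
  have comp := @isComponent_sSup_iff 𝓕 hc hd
  refine ⟨sSup 𝓕, ⟨?_, ?_, ?_⟩, ?_⟩
  · refine sSup_le ?_
    rintro M (⟨h, hh, rfl⟩ | ⟨v, e, h1, h2, rfl⟩)
    · exact le_iSup₂_of_le (f := fun h (_ : h ∈ H) => hexagon h) h (hSH hh) le_rfl
    · obtain ⟨h, hh, h3, h4⟩ := (hp v h1 h2).2.2.2
      refine le_trans ?_ (le_iSup₂_of_le (f := fun h (_ : h ∈ H) => hexagon h) h hh le_rfl)
      rw [SimpleGraph.subgraphOfAdj_le_iff]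
      exact hexagon_adj.2 ⟨h3, h4, e⟩
  · ext v
    rw [mem_hexGraph_verts]
    simp only [SimpleGraph.Subgraph.verts_sSup, Set.mem_iUnion, exists_prop]
    constructor
    · rintro ⟨M, ⟨h, hh, rfl⟩ | ⟨w, e, h1, h2, rfl⟩, hv⟩
      · exact ⟨h, hSH hh, hv⟩
      · obtain ⟨h, hh, h3, h4⟩ := (hp w h1 h2).2.2.2
        rcases hv with rfl | rfl
        exacts [⟨h, hh, h3⟩, ⟨h, hh, h4⟩]
    · intro hv
      by_cases hvS : ∀ h ∈ S, v ∉ corners h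
      · exact ⟨_, Or.inr ⟨v, (hp v hv hvS).2.2.1, hv, hvS, rfl⟩, by simp⟩
      · push Not at hvS
        obtain ⟨h, hh, hv⟩ := hvS
        exact ⟨_, Or.inl ⟨h, hh, rfl⟩, hv⟩
  · intro D hD
    rcases comp.1 hD with ⟨h, hh, rfl⟩ | ⟨v, e, -, -, rfl⟩
    · exact Or.inl ⟨h, hSH hh, rfl⟩
    · exact Or.inr ⟨_, _, e, rfl⟩
  · intro h
    constructor
    · exact fun hh => ⟨hSH hh, comp.2 (Or.inl ⟨h, hh, rfl⟩)⟩
    · rintro ⟨-, hh⟩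
      rcases comp.1 hh with ⟨h', hh', h2⟩ | ⟨v, e, -, -, h2⟩
      · rwa [← hexagon_injective h2]
      · -- A hexagon has at least three vertices, so it is not a single edge.
        exfalso
        have m : ∀ a : ℤ, 0 ≤ a → a ≤ 2 → (2 * h.1 + h.2 + a, h.2) ∈ (hexagon h).verts := by
          intro a _ _
          simp only [hexagon_verts, corners, Set.mem_ofPred_eq]; omega
        have m0 := m 0 (by simp) (by simp)
        have m1 := m 1 (by simp) (by simp)
        have m2 := m 2 (by simp) (by simp)
        rw [h2] at m0 m1 m2
        simp only [SimpleGraph.subgraphOfAdj_verts, Set.mem_insert_iff,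
          Set.mem_singleton_iff, Prod.ext_iff] at m0 m1 m2
        omega

/-- Two cells overlap if they coincide or share a side, that is, if their sets of corners, which are
`3 × 2` boxes in brick-wall coordinates, intersect. -/
def Overlap (h h' : ℤ × ℤ) : Prop :=
  |2 * (h.1 - h'.1) + (h.2 - h'.2)| ≤ 2 ∧ |h.2 - h'.2| ≤ 1

instance : DecidableRel Overlap := fun _ _ => inferInstanceAs (Decidable (_ ∧ _))

theorem overlap_iff {h h' : ℤ × ℤ} : Overlap h h' ↔ ∃ v, v ∈ corners h ∧ v ∈ corners h' := by
  obtain ⟨i, j⟩ := h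
  obtain ⟨k, l⟩ := h'
  simp only [Overlap, corners, Set.mem_ofPred_eq, abs_le]
  constructor
  · intro h
    exact ⟨(max (2 * i + j) (2 * k + l), max j l), by dsimp only; omega⟩
  · rintro ⟨⟨x, y⟩, h⟩
    dsimp only at h
    omega

theorem mem_pyreneChain {n : ℕ} {h : ℤ × ℤ} : h ∈ pyreneChain n ↔
    (h.2 = 0 ∧ 0 ≤ h.1 ∧ h.1 < 2 * n) ∨ (h.2 = 1 ∧ 0 ≤ h.1 ∧ h.1 < 2 * n ∧ h.1 % 2 = 0) ∨
      (h.2 = -1 ∧ 0 ≤ h.1 ∧ h.1 < 2 * n ∧ h.1 % 2 = 1) := by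
  obtain ⟨a, b⟩ := h
  simp only [pyreneChain, Finset.mem_biUnion, Finset.mem_range, Finset.mem_insert,
    Finset.mem_singleton, Prod.mk.injEq]
  constructor
  · rintro ⟨i, hi, h⟩
    omega
  · intro h
    exact ⟨(a / 2).toNat, by omega, by omega⟩

/-- The partner of a vertex of the pyrene chain in the matching that extends the pattern `S`. The
four columns of vertices `4q, …, 4q + 3` are matched among themselves, in a way that depends only on
whether the right hexagon `(2q + 1, 0)` of the row belongs to `S`. -/
def partner (S : Finset (ℤ × ℤ)) (v : ℤ × ℤ) : ℤ × ℤ :=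
  if v.1 % 4 = 0 then (v.1, 1 - v.2)
  else if (2 * (v.1 / 4) + 1, 0) ∈ S then
    if v.1 % 4 = 1 then (v.1, if v.2 = 2 then 1 else if v.2 = 1 then 2 else -1 - v.2)
    else if v.1 % 4 = 2 then (v.1 + 1, v.2) else (v.1 - 1, v.2)
  else
    if v.1 % 4 = 1 then (v.1 + 1, v.2) else if v.1 % 4 = 2 then (v.1 - 1, v.2)
    else (v.1, if v.2 = 2 then 1 else if v.2 = 1 then 2 else -1 - v.2)

theorem mem_corners {h v : ℤ × ℤ} : v ∈ corners h ↔
    2 * h.1 + h.2 ≤ v.1 ∧ v.1 ≤ 2 * h.1 + h.2 + 2 ∧ h.2 ≤ v.2 ∧ v.2 ≤ h.2 + 1 := Iff.rfl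

/-- `partner S` matches the vertices outside the hexagons of `S` along sides of cells. -/
theorem partner_spec {n : ℕ} {S : Finset (ℤ × ℤ)} (hS : S ⊆ pyreneChain n)
    (hd : ∀ h ∈ S, ∀ h' ∈ S, Overlap h h' → h = h') {v : ℤ × ℤ}
    (hv : ∃ h ∈ pyreneChain n, v ∈ corners h) (hvS : ∀ h ∈ S, v ∉ corners h) :
    (∀ h ∈ S, partner S v ∉ corners h) ∧ partner S (partner S v) = v ∧
      hexLattice.Adj v (partner S v) ∧
        ∃ h ∈ pyreneChain n, v ∈ corners h ∧ partner S v ∈ corners h := by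
  obtain ⟨x, y⟩ := v
  obtain ⟨q, r, hr0, hr4, rfl⟩ : ∃ q r : ℤ, 0 ≤ r ∧ r < 4 ∧ x = 4 * q + r :=
    ⟨x / 4, x % 4, by omega, by omega, by omega⟩
  have hq : ∀ s : ℤ, 0 ≤ s → s < 4 → (4 * q + s) % 4 = s ∧ (4 * q + s) / 4 = q := by omega
  -- The hexagons of `S` other than `(2q + 1, 0)` do not meet it.
  have hR : (2 * q + 1, 0) ∈ S → ∀ h ∈ S, h = (2 * q + 1, 0) ∨
      ¬ (|2 * (2 * q + 1 - h.1) + (0 - h.2)| ≤ 2 ∧ |0 - h.2| ≤ 1) := fun hc h hh =>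
    or_iff_not_imp_right.2 fun h' => (hd _ hc h hh (not_not.1 h')).symm
  have hne : ∀ h ∈ S, (2 * q + 1, 0) ∉ S → h ≠ (2 * q + 1, 0) := by
    rintro h hh hc rfl
    exact hc hh
  simp only [mem_corners, mem_pyreneChain, abs_le, Prod.ext_iff, ne_eq] at hv hvS hR hne
  obtain ⟨⟨i, j⟩, hij, hv⟩ := hv
  have hSP := fun h (hh : h ∈ S) => mem_pyreneChain.1 (hS hh)
  -- The vertices of `(2q + 1, 0)` are covered if it belongs to `S`.
  have hcov : (2 * q + 1, 0) ∈ S → ¬ (2 ≤ r ∧ 0 ≤ y ∧ y ≤ 1) := by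
    intro hc
    have := hvS _ hc
    dsimp only at this
    omega
  dsimp only at hij hv
  -- `w` is the partner of `(4q + r, y)`, and `g` a cell that contains both.
  have fin : ∀ w : ℤ × ℤ, partner S (4 * q + r, y) = w → partner S w = (4 * q + r, y) →
      hexLattice.Adj (4 * q + r, y) w → (∀ h ∈ S, w ∉ corners h) →
      (∃ g ∈ pyreneChain n, (4 * q + r, y) ∈ corners g ∧ w ∈ corners g) →
      (∀ h ∈ S, partner S (4 * q + r, y) ∉ corners h) ∧
        partner S (partner S (4 * q + r, y)) = (4 * q + r, y) ∧
        hexLattice.Adj (4 * q + r, y) (partner S (4 * q + r, y)) ∧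
        ∃ h ∈ pyreneChain n, (4 * q + r, y) ∈ corners h ∧
          partner S (4 * q + r, y) ∈ corners h := by
    rintro w rfl h1 h2 h3 h4
    exact ⟨h3, h1, h2, h4⟩
  have hy : y = -1 ∨ y = 0 ∨ y = 1 ∨ y = 2 := by omega
  have hp0 : ∀ y, partner S (4 * q + 0, y) = (4 * q + 0, 1 - y) := by
    intro y; simp [partner]
  have ev : ∀ a : ℤ, Even a ↔ a % 2 = 0 := fun a => Int.even_iff
  obtain rfl | hr : r = 0 ∨ r ≠ 0 := by omega
  · have hy' : y = 0 ∨ y = 1 := by omega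
    refine fin (4 * q + 0, 1 - y) (hp0 y) ?_ ?_ ?_ ?_
    · rw [hp0]; simp
    · rw [hexLattice_adj]; simp only [Prod.ext_iff, ev, true_and]; omega
    · intro h hh
      have h1 := hSP h hh
      have h2 := hvS h hh
      rw [mem_corners]; dsimp only; omega
    · refine ⟨(i, 0), mem_pyreneChain.2 ?_, ?_⟩
      · exact Or.inl ⟨rfl, by dsimp only; omega⟩
      · simp only [mem_corners]; omega
  -- The other pairs lie in the cells above and below the row.
  have hTB : (if 1 ≤ y then (2 * q, 1) else (2 * q + 1, -1)) ∈ pyreneChain n := by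
    rw [mem_pyreneChain]
    split_ifs
    · exact Or.inr (Or.inl ⟨rfl, by dsimp only; omega⟩)
    · exact Or.inr (Or.inr ⟨rfl, by dsimp only; omega⟩)
  by_cases hc : (2 * q + 1, 0) ∈ S
  · have hp1 : ∀ y, partner S (4 * q + 1, y) =
        (4 * q + 1, if y = 2 then 1 else if y = 1 then 2 else -1 - y) := by
      intro y; simp [partner, hq 1, hc]
    have hp2 : ∀ y, partner S (4 * q + 2, y) = (4 * q + 3, y) := by
      intro y; simp [partner, hq 2, hc]; ring
    have hp3 : ∀ y, partner S (4 * q + 3, y) = (4 * q + 2, y) := by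
      intro y; simp [partner, hq 3, hc]; ring
    have hcov := hcov hc
    obtain rfl | rfl | rfl : r = 1 ∨ r = 2 ∨ r = 3 := by omega
    · refine fin _ (hp1 y) ?_ ?_ ?_ ?_
      · rw [hp1]; ext
        · rfl
        · dsimp only; split_ifs <;> omega
      · rw [hexLattice_adj]; simp only [Prod.ext_iff, ev, true_and]; split_ifs <;> omega
      · intro h hh
        have h1 := hSP h hh
        have h2 := hvS h hh
        have h3 := hR hc h hh
        rw [mem_corners]; dsimp only; split_ifs <;> omega
      · refine ⟨_, hTB, ?_⟩
        simp only [mem_corners]; split_ifs <;> dsimp only <;> omega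
    · refine fin _ (hp2 y) (hp3 y) ?_ ?_ ?_
      · rw [hexLattice_adj]; simp only [Prod.ext_iff, and_true]; omega
      · intro h hh
        have h1 := hSP h hh
        have h2 := hvS h hh
        have h3 := hR hc h hh
        rw [mem_corners]; dsimp only; omega
      · refine ⟨_, hTB, ?_⟩
        simp only [mem_corners]; split_ifs <;> dsimp only <;> omega
    · refine fin _ (hp3 y) (hp2 y) ?_ ?_ ?_
      · rw [hexLattice_adj]; simp only [Prod.ext_iff, and_true]; omega
      · intro h hh
        have h1 := hSP h hh
        have h2 := hvS h hh
        have h3 := hR hc h hh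
        rw [mem_corners]; dsimp only; omega
      · refine ⟨_, hTB, ?_⟩
        simp only [mem_corners]; split_ifs <;> dsimp only <;> omega
  · have hp3 : ∀ y, partner S (4 * q + 3, y) =
        (4 * q + 3, if y = 2 then 1 else if y = 1 then 2 else -1 - y) := by
      intro y; simp [partner, hq 3, hc]
    have hp1 : ∀ y, partner S (4 * q + 1, y) = (4 * q + 2, y) := by
      intro y; simp [partner, hq 1, hc]; ring
    have hp2 : ∀ y, partner S (4 * q + 2, y) = (4 * q + 1, y) := by
      intro y; simp [partner, hq 2, hc]; ring
    obtain rfl | rfl | rfl : r = 1 ∨ r = 2 ∨ r = 3 := by omega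
    · refine fin _ (hp1 y) (hp2 y) ?_ ?_ ?_
      · rw [hexLattice_adj]; simp only [Prod.ext_iff, and_true]; omega
      · intro h hh
        have h1 := hSP h hh
        have h2 := hvS h hh
        have h3 := hne h hh hc
        rw [mem_corners]; dsimp only; omega
      · refine ⟨_, hTB, ?_⟩
        simp only [mem_corners]; split_ifs <;> dsimp only <;> omega
    · refine fin _ (hp2 y) (hp1 y) ?_ ?_ ?_
      · rw [hexLattice_adj]; simp only [Prod.ext_iff, and_true]; omega
      · intro h hh
        have h1 := hSP h hh
        have h2 := hvS h hh
        have h3 := hne h hh hc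
        rw [mem_corners]; dsimp only; omega
      · refine ⟨_, hTB, ?_⟩
        simp only [mem_corners]; split_ifs <;> dsimp only <;> omega
    · refine fin _ (hp3 y) ?_ ?_ ?_ ?_
      · rw [hp3]; ext
        · rfl
        · dsimp only; split_ifs <;> omega
      · rw [hexLattice_adj]; simp only [Prod.ext_iff, ev, true_and]; split_ifs <;> omega
      · intro h hh
        have h1 := hSP h hh
        have h2 := hvS h hh
        have h3 := hne h hh hc
        rw [mem_corners]; dsimp only; split_ifs <;> omega
      · refine ⟨_, hTB, ?_⟩
        simp only [mem_corners]; split_ifs <;> dsimp only <;> omega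

/-- The resonant patterns of a pyrene chain are the sets of pairwise disjoint hexagons. -/
theorem isResonantPattern_pyreneChain {n : ℕ} {S : Finset (ℤ × ℤ)} :
    IsResonantPattern (pyreneChain n) S ↔
      S ⊆ pyreneChain n ∧ ∀ h ∈ S, ∀ h' ∈ S, Overlap h h' → h = h' := by
  constructor
  · rintro ⟨C, -, hS⟩
    refine ⟨fun h hh => ((hS h).1 hh).1, fun h hh h' hh' ho => ?_⟩
    obtain ⟨v, hv, hv'⟩ := overlap_iff.1 ho
    exact hexagon_injective (((hS h).1 hh).2.eq_of_mem ((hS h').1 hh').2 hv hv')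
  · rintro ⟨hS, hd⟩
    exact isResonantPattern_of_involution hS
      (fun h hh h' hh' v hv hv' => hd h hh h' hh' (overlap_iff.2 ⟨v, hv, hv'⟩)) (partner S)
      fun v hv hvS => partner_spec hS hd hv hvS

/-! ### The sextet polynomial of a pyrene chain -/

open Polynomial in
/-- The generating polynomial, by size, of the sets of pairwise disjoint cells of `A`. -/
def indepPoly (A : Finset (ℤ × ℤ)) : ℝ[X] :=
  ∑ S ∈ A.powerset with ∀ h ∈ S, ∀ h' ∈ S, Overlap h h' → h = h', X ^ S.card

theorem overlap_comm {h h' : ℤ × ℤ} : Overlap h h' ↔ Overlap h' h := by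
  simp only [overlap_iff, and_comm]

open Polynomial in
theorem indepPoly_empty : indepPoly ∅ = 1 := by
  simp [indepPoly, Finset.sum_filter]

open Polynomial in
/-- Deletion recurrence: a set of disjoint cells either avoids `v`, or contains `v` and otherwise
only cells of `A` that do not overlap `v`. -/
theorem indepPoly_insert {v : ℤ × ℤ} {A B : Finset (ℤ × ℤ)} (hv : v ∉ A)
    (hB : ∀ h, h ∈ B ↔ h ∈ A ∧ ¬ Overlap v h) :
    indepPoly (insert v A) = indepPoly A + X * indepPoly B := by
  simp only [indepPoly, Finset.sum_filter]
  rw [Finset.sum_powerset_insert hv]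
  congr 1
  rw [Finset.mul_sum]
  have hBA : B ⊆ A := fun h hh => ((hB h).1 hh).1
  rw [← Finset.sum_subset (Finset.powerset_mono.2 hBA)]
  · refine Finset.sum_congr rfl fun S hS => ?_
    rw [Finset.mem_powerset] at hS
    have hvS : v ∉ S := fun h => hv (hBA (hS h))
    have hno : ∀ h ∈ S, ¬ Overlap v h := fun h hh => ((hB h).1 (hS hh)).2
    rw [Finset.card_insert_of_notMem hvS, pow_succ', mul_ite, mul_zero]
    refine if_congr ⟨fun H h hh h' hh' => H h (Finset.mem_insert_of_mem hh) h'
      (Finset.mem_insert_of_mem hh'), fun H => ?_⟩ rfl rfl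
    intro h hh h' hh' ho
    rcases Finset.mem_insert.1 hh with h1 | h1 <;> rcases Finset.mem_insert.1 hh' with h2 | h2
    · rw [h1, h2]
    · exact absurd (h1 ▸ ho) (hno _ h2)
    · exact absurd (overlap_comm.1 (h2 ▸ ho)) (hno _ h1)
    · exact H h h1 h' h2 ho
  · intro S hS hSB
    rw [Finset.mem_powerset] at hS hSB
    refine if_neg fun H => hSB fun h hh => (hB h).2 ⟨hS hh, fun ho => ?_⟩
    have := H v (Finset.mem_insert_self _ _) h (Finset.mem_insert_of_mem hh) ho
    exact hv (this ▸ hS hh)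

/-- The sextet polynomial of `P_n`, defined through sets of disjoint cells; by `coeff_sextetPoly`
its coefficients are the numbers `s(P_n, k)`. -/
def sextetPoly (n : ℕ) : Polynomial ℝ := indepPoly (pyreneChain n)

theorem coeff_sextetPoly (n k : ℕ) : (sextetPoly n).coeff k = pyreneNumber n k := by
  rw [sextetPoly, indepPoly, Polynomial.finsetSum_coeff]
  simp only [Polynomial.coeff_X_pow]
  rw [Finset.sum_boole, Finset.filter_filter, pyreneNumber, resonantNumber,
    ← Set.ncard_coe_finset]
  congr 2
  ext S
  simp [isResonantPattern_pyreneChain, and_assoc, eq_comm]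

theorem pyreneChain_zero : pyreneChain 0 = ∅ := rfl

open Polynomial in
/-- The contribution of the cells of the last pyrene; `(2n - 1, 0)` is the only earlier cell that
meets any of them. -/
theorem sextetPoly_succ (n : ℕ) :
    sextetPoly (n + 1) = ((1 + X) ^ 2 + X) * sextetPoly n +
      X * indepPoly ((pyreneChain n).erase (2 * (n : ℤ) - 1, 0)) ∧
    sextetPoly (n + 1) = indepPoly ((pyreneChain (n + 1)).erase (2 * (n : ℤ) + 1, 0)) +
      X * sextetPoly n := by
  set B : ℤ × ℤ := (2 * (n : ℤ) + 1, -1) with hB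
  set T : ℤ × ℤ := (2 * (n : ℤ), 1) with hT
  set L : ℤ × ℤ := (2 * (n : ℤ), 0) with hL
  set R : ℤ × ℤ := (2 * (n : ℤ) + 1, 0) with hR
  have hP : pyreneChain (n + 1) =
      insert R (insert L (insert T (insert B (pyreneChain n)))) := by
    ext ⟨a, b⟩
    simp only [Finset.mem_insert, mem_pyreneChain, hB, hT, hL, hR, Prod.mk.injEq]
    push_cast
    omega
  have nB : B ∉ pyreneChain n := by
    simp only [mem_pyreneChain, hB]; omega
  have nT : T ∉ insert B (pyreneChain n) := by
    simp only [Finset.mem_insert, mem_pyreneChain, hB, hT, Prod.mk.injEq]; omega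
  have nL : L ∉ insert T (insert B (pyreneChain n)) := by
    simp only [Finset.mem_insert, mem_pyreneChain, hB, hT, hL, Prod.mk.injEq]; omega
  have nR : R ∉ insert L (insert T (insert B (pyreneChain n))) := by
    simp only [Finset.mem_insert, mem_pyreneChain, hB, hT, hL, hR, Prod.mk.injEq]; omega
  have e1 := indepPoly_insert (B := pyreneChain n) nR (by
    rintro ⟨a, b⟩
    simp only [Finset.mem_insert, mem_pyreneChain, hB, hT, hL, hR, Prod.mk.injEq, Overlap, abs_le]
    omega)
  have e2 := indepPoly_insert (B := (pyreneChain n).erase (2 * (n : ℤ) - 1, 0)) nL (by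
    rintro ⟨a, b⟩
    simp only [Finset.mem_insert, Finset.mem_erase, mem_pyreneChain, hB, hT, hL, ne_eq,
      Prod.mk.injEq, Overlap, abs_le]
    omega)
  have e3 := indepPoly_insert (B := insert B (pyreneChain n)) nT (by
    rintro ⟨a, b⟩
    simp only [Finset.mem_insert, mem_pyreneChain, hB, hT, Prod.mk.injEq, Overlap, abs_le]
    omega)
  have e4 := indepPoly_insert (B := pyreneChain n) nB (by
    rintro ⟨a, b⟩
    simp only [mem_pyreneChain, hB, Overlap, abs_le]
    omega)
  have hE : (pyreneChain (n + 1)).erase R = insert L (insert T (insert B (pyreneChain n))) := by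
    rw [hP, Finset.erase_insert nR]
  constructor
  · rw [sextetPoly, sextetPoly, hP, e1, e2, e3, e4]; ring
  · rw [sextetPoly, sextetPoly, hE, ← e1, hP]

open Polynomial in
theorem sextetPoly_zero : sextetPoly 0 = 1 := by
  rw [sextetPoly, pyreneChain_zero, indepPoly_empty]

open Polynomial in
theorem sextetPoly_one : sextetPoly 1 = 1 + 4 * X + X ^ 2 := by
  have h := (sextetPoly_succ 0).1
  rw [pyreneChain_zero, Finset.erase_empty, indepPoly_empty, sextetPoly_zero] at h
  rw [h]; ring

open Polynomial in
/-- The two formulas of `sextetPoly_succ` share the polynomial of a chain without its last cell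
`(2n + 1, 0)` of the row; eliminating it gives the recurrence. -/
theorem sextetPoly_add_two (n : ℕ) :
    sextetPoly (n + 2) = (1 + 4 * X + X ^ 2) * sextetPoly (n + 1) - X ^ 2 * sextetPoly n := by
  have h1 := (sextetPoly_succ (n + 1)).1
  have h2 := (sextetPoly_succ n).2
  have e : 2 * ((n + 1 : ℕ) : ℤ) - 1 = 2 * (n : ℤ) + 1 := by push_cast; ring
  rw [e] at h1
  rw [h1, eq_sub_of_add_eq h2.symm]; ring

open Polynomial.Chebyshev in
/-- The recurrence of the sextet polynomials is that of the Chebyshev polynomials of the second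
kind, after the substitution `(1 + 4x + x²) / (2x)`. -/
theorem eval_sextetPoly_eq_U (n : ℕ) {x : ℝ} (hx : x ≠ 0) :
    (sextetPoly n).eval x = x ^ n * (U ℝ n).eval ((1 + 4 * x + x ^ 2) / (2 * x)) := by
  induction n using Nat.twoStepInduction with
  | zero => simp [sextetPoly_zero]
  | one =>
    simp [sextetPoly_one]
    field_simp
  | more n h1 h2 =>
    rw [sextetPoly_add_two]
    push_cast at h2 ⊢
    rw [U_add_two]
    simp only [Polynomial.eval_sub, Polynomial.eval_mul, Polynomial.eval_add,
      Polynomial.eval_one, Polynomial.eval_ofNat, Polynomial.eval_X, Polynomial.eval_pow, h1, h2]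
    field_simp
    ring

/-- The cosines of `(k + 1)π / (n + 1)`, the roots of the Chebyshev polynomial `U_n`. -/
def node (n k : ℕ) : ℝ := Real.cos ((k + 1) * Real.pi / (n + 1))

theorem abs_node_le (n k : ℕ) : |node n k| ≤ 1 := Real.abs_cos_le_one _

open Polynomial Polynomial.Chebyshev in
theorem U_eq_prod (n : ℕ) :
    U ℝ n = C (2 ^ n) * ∏ k ∈ Finset.range n, (X - C (node n k)) := by
  have hinj : Set.InjOn (node n) (Finset.range n) :=
    (Finset.nodup_map_iff_injOn (f := node n)).mp (roots_U_real_nodup n)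
  have hroots : (U ℝ n).roots = ((Finset.range n).image (node n)).val := roots_U_real n
  have hcard : (U ℝ n).roots.card = (U ℝ n).natDegree := by
    rw [hroots, natDegree_U_natCast, Finset.card_val, Finset.card_image_of_injOn hinj,
      Finset.card_range]
  have h := C_leadingCoeff_mul_prod_multiset_X_sub_C hcard
  rw [leadingCoeff_U_natCast, hroots] at h
  rw [← h]
  congr 1
  rw [Finset.image_val_of_injOn hinj, Multiset.map_map]
  rfl

open Polynomial in
theorem sextetPoly_eq_prod (n : ℕ) :
    sextetPoly n = ∏ k ∈ Finset.range n, (X ^ 2 + C (4 - 2 * node n k) * X + 1) := by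
  refine Polynomial.funext fun x => ?_
  obtain rfl | hx := eq_or_ne x 0
  · have h : (sextetPoly n).eval 0 = 1 := by
      induction n using Nat.twoStepInduction with
      | zero => simp [sextetPoly_zero]
      | one => simp [sextetPoly_one]
      | more n _ h2 => simp [sextetPoly_add_two, h2]
    rw [h, eval_prod]
    simp
  · rw [eval_sextetPoly_eq_U n hx, U_eq_prod]
    simp only [eval_mul, eval_C, eval_prod, eval_sub, eval_X, eval_add, eval_pow, eval_one]
    have h2 : (2 * x) ^ n = ∏ _k ∈ Finset.range n, (2 * x) := by simp
    rw [← mul_assoc, ← mul_pow, mul_comm x, h2, ← Finset.prod_mul_distrib]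
    refine Finset.prod_congr rfl fun k _ => ?_
    field_simp
    ring

/-! ### Mean and variance -/

open Polynomial in
theorem hasSum_coeff (q : ℝ[X]) : HasSum q.coeff (q.eval 1) := by
  induction q using Polynomial.induction_on' with
  | add p q hp hq =>
    rw [eval_add]
    exact (hp.add hq).congr_fun fun k => coeff_add p q k
  | monomial n a =>
    convert! hasSum_ite_eq n a using 1
    · funext k
      rw [coeff_monomial]
      exact if_congr eq_comm rfl rfl
    · simp

open Polynomial in
theorem hasSum_mul_coeff (q : ℝ[X]) :
    HasSum (fun k : ℕ => (k : ℝ) * q.coeff k) (q.derivative.eval 1) := by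
  convert! hasSum_coeff (X * derivative q) using 1
  · ext k
    cases k with
    | zero => simp
    | succ k => rw [coeff_X_mul, coeff_derivative]; push_cast; ring
  · simp

open Polynomial in
theorem hasSum_sq_mul_coeff (q : ℝ[X]) :
    HasSum (fun k : ℕ => (k : ℝ) ^ 2 * q.coeff k)
      (q.derivative.derivative.eval 1 + q.derivative.eval 1) := by
  convert! hasSum_mul_coeff (X * derivative q) using 1
  · ext k
    cases k with
    | zero => simp
    | succ k => rw [coeff_X_mul, coeff_derivative]; push_cast; ring
  · simp [add_comm]

/-- The variance of `p(n, ·)`, a sum over the quadratic factors of the sextet polynomial. -/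
def var (n : ℕ) : ℝ := ∑ k ∈ Finset.range n, 1 / (3 - node n k)

theorem two_le_three_sub_node (n k : ℕ) : 2 ≤ 3 - node n k := by
  linarith [(abs_le.1 (abs_node_le n k)).2]

theorem three_sub_node_le (n k : ℕ) : 3 - node n k ≤ 4 := by
  linarith [(abs_le.1 (abs_node_le n k)).1]

open Polynomial in
/-- A product of `m` palindromic quadratics `x² + (4 - 2c)x + 1` has mean `m`, and its variance is
the sum of the variances of the factors. -/
theorem derivatives_prod (s : Finset ℕ) (c : ℕ → ℝ) (hc : ∀ k, 2 ≤ 3 - c k) :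
    let F : ℝ[X] := ∏ k ∈ s, (X ^ 2 + C (4 - 2 * c k) * X + 1)
    0 < F.eval 1 ∧ F.derivative.eval 1 = s.card * F.eval 1 ∧
      F.derivative.derivative.eval 1 =
        F.eval 1 * (∑ k ∈ s, 1 / (3 - c k) + s.card * (s.card - 1)) := by
  classical
  induction s using Finset.induction_on with
  | empty => simp
  | insert a s ha ih =>
    obtain ⟨h0, h1, h2⟩ := ih
    simp only [Finset.prod_insert ha, Finset.sum_insert ha, Finset.card_insert_of_notMem ha]
    set F : ℝ[X] := ∏ k ∈ s, (X ^ 2 + C (4 - 2 * c k) * X + 1)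
    have hne : 3 - c a ≠ 0 := by linarith [hc a]
    simp only [derivative_mul, derivative_add, eval_add, eval_mul, h1, h2]
    simp only [derivative_mul, derivative_X_pow, derivative_C, derivative_X, derivative_one,
      eval_add, eval_mul, eval_pow, eval_X, eval_C, eval_one, eval_zero]
    refine ⟨?_, ?_, ?_⟩
    · have := hc a
      refine mul_pos ?_ h0
      linarith
    · push_cast; simp; ring
    · push_cast; simp; field_simp; ring

theorem sextetPoly_moments (n : ℕ) :
    0 < (sextetPoly n).eval 1 ∧
      (sextetPoly n).derivative.eval 1 = n * (sextetPoly n).eval 1 ∧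
      (sextetPoly n).derivative.derivative.eval 1 =
        (sextetPoly n).eval 1 * (var n + n * (n - 1)) := by
  have h := derivatives_prod (Finset.range n) (node n) (two_le_three_sub_node n)
  simp only [← sextetPoly_eq_prod, Finset.card_range] at h
  exact h

theorem normalizedProb_natCast (n k : ℕ) :
    normalizedProb pyreneNumber n k = (sextetPoly n).coeff k / (sextetPoly n).eval 1 := by
  rw [normalizedProb, if_pos (Int.natCast_nonneg k), Int.toNat_natCast, ← coeff_sextetPoly,
    ← (hasSum_coeff (sextetPoly n)).tsum_eq]
  simp only [coeff_sextetPoly]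

theorem normalizedProb_of_neg (n : ℕ) {m : ℤ} (hm : m < 0) :
    normalizedProb pyreneNumber n m = 0 := if_neg (not_le.2 hm)

theorem normalizedProb_nonneg (n : ℕ) (m : ℤ) : 0 ≤ normalizedProb pyreneNumber n m := by
  rw [normalizedProb]
  split_ifs
  · exact div_nonneg (Nat.cast_nonneg _) (tsum_nonneg fun _ => Nat.cast_nonneg _)
  · exact le_rfl

theorem seqMean_pyreneNumber (n : ℕ) : seqMean pyreneNumber n = n := by
  obtain ⟨h0, h1, -⟩ := sextetPoly_moments n
  have h := (hasSum_mul_coeff (sextetPoly n)).div_const ((sextetPoly n).eval 1)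
  rw [seqMean]
  simp only [normalizedProb_natCast, ← mul_div_assoc, h.tsum_eq]
  rw [h1, mul_div_cancel_right₀ _ h0.ne']

theorem seqVariance_pyreneNumber (n : ℕ) : seqVariance pyreneNumber n = var n := by
  obtain ⟨h0, h1, h2⟩ := sextetPoly_moments n
  have h := (((hasSum_sq_mul_coeff (sextetPoly n)).sub
    ((hasSum_mul_coeff (sextetPoly n)).mul_left (2 * (n : ℝ)))).add
    ((hasSum_coeff (sextetPoly n)).mul_left ((n : ℝ) ^ 2))).div_const ((sextetPoly n).eval 1)
  rw [seqVariance]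
  simp only [normalizedProb_natCast, seqMean_pyreneNumber]
  rw [show (fun k : ℕ => ((k : ℝ) - n) ^ 2 * ((sextetPoly n).coeff k / (sextetPoly n).eval 1)) =
    fun k : ℕ => ((k : ℝ) ^ 2 * (sextetPoly n).coeff k - 2 * n * (k * (sextetPoly n).coeff k) +
      (n : ℝ) ^ 2 * (sextetPoly n).coeff k) / (sextetPoly n).eval 1 by ext k; ring,
    h.tsum_eq, h1, h2]
  field_simp
  ring

/-- The two sums agree after reversing the order of summation, which turns `cos θ` into `-cos θ`. -/
theorem var_eq (n : ℕ) : var n = 1 / 2 * ∑ k ∈ Finset.Icc 1 n,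
    1 / (1 + Real.cos ((k : ℝ) * Real.pi / (2 * (n : ℝ) + 2)) ^ 2) := by
  rw [var, ← Finset.sum_range_reflect, Finset.mul_sum, Finset.range_eq_Ico,
    ← Finset.Ico_add_one_right_eq_Icc, ← Finset.sum_Ico_add' _ 0 n 1]
  refine Finset.sum_congr rfl fun k hk => ?_
  have hk : k < n := (Finset.mem_Ico.1 hk).2
  obtain ⟨m, rfl⟩ : ∃ m, n = k + m + 1 := ⟨n - k - 1, by omega⟩
  have e1 : ((k + m + 1 - 1 - k : ℕ) : ℝ) = m := by congr 1; omega
  have hn : (k : ℝ) + m + 1 + 1 ≠ 0 := by positivity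
  have e2 : node (k + m + 1) (k + m + 1 - 1 - k) =
      1 - 2 * Real.cos (((k + 1 : ℕ) : ℝ) * Real.pi / (2 * ((k + m + 1 : ℕ) : ℝ) + 2)) ^ 2 := by
    have h := Real.cos_two_mul (((k + 1 : ℕ) : ℝ) * Real.pi / (2 * ((k + m + 1 : ℕ) : ℝ) + 2))
    rw [node, e1]
    have h3 : ((m : ℝ) + 1) * Real.pi / (((k + m + 1 : ℕ) : ℝ) + 1) = Real.pi -
        2 * (((k + 1 : ℕ) : ℝ) * Real.pi / (2 * ((k + m + 1 : ℕ) : ℝ) + 2)) := by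
      push_cast
      field_simp
      ring
    rw [h3, Real.cos_pi_sub, h]
    ring
  rw [e2]
  set x := Real.cos (((k + 1 : ℕ) : ℝ) * Real.pi / (2 * ((k + m + 1 : ℕ) : ℝ) + 2))
  have : 1 + x ^ 2 ≠ 0 := by positivity
  have : 3 - (1 - 2 * x ^ 2) ≠ 0 := by nlinarith [sq_nonneg x]
  field_simp
  ring

theorem le_var (n : ℕ) : (n : ℝ) / 4 ≤ var n := by
  have : ∑ _k ∈ Finset.range n, (1 / 4 : ℝ) ≤ var n :=
    Finset.sum_le_sum fun k _ => one_div_le_one_div_of_le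
      (by linarith [two_le_three_sub_node n k]) (three_sub_node_le n k)
  simp at this
  linarith

open Polynomial Polynomial.Chebyshev in
/-- `var n` is the logarithmic derivative of `U_n` at `3`. -/
theorem eval_derivative_U_three (n : ℕ) :
    (derivative (U ℝ n)).eval 3 = var n * (U ℝ n).eval 3 := by
  have aux : ∀ s : Finset ℕ, (derivative (∏ k ∈ s, (X - C (node n k)))).eval 3 =
      (∑ k ∈ s, 1 / (3 - node n k)) * (∏ k ∈ s, (X - C (node n k))).eval 3 := by
    intro s
    induction s using Finset.induction_on with
    | empty => simp
    | insert a s ha ih =>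
      have : 3 - node n a ≠ 0 := by linarith [two_le_three_sub_node n a]
      simp only [Finset.prod_insert ha, Finset.sum_insert ha, derivative_mul, eval_add, eval_mul,
        ih, derivative_sub, derivative_X, derivative_C, eval_sub, eval_X, eval_C, eval_one,
        eval_zero]
      field_simp
      ring
  rw [U_eq_prod, derivative_C_mul, eval_C_mul, eval_C_mul, aux, var]
  ring

open Polynomial.Chebyshev in
/-- The values `T_{n+1}(3)` and `U_n(3)` solve a Pell equation. -/
theorem pell_chebyshev (n : ℕ) :
    ((T ℝ (n + 1)).eval 3) ^ 2 - 8 * ((U ℝ n).eval 3) ^ 2 = 1 ∧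
      0 < (T ℝ (n + 1)).eval 3 ∧ (n : ℝ) + 1 ≤ (U ℝ n).eval 3 := by
  induction n with
  | zero => simp; norm_num
  | succ n ih =>
    obtain ⟨h1, h2, h3⟩ := ih
    have a := congrArg (Polynomial.eval (3 : ℝ)) (T_eq_X_mul_T_sub_pol_U ℝ n)
    have b := congrArg (Polynomial.eval (3 : ℝ)) (U_eq_X_mul_U_add_T ℝ n)
    simp only [Polynomial.eval_add, Polynomial.eval_sub, Polynomial.eval_mul, Polynomial.eval_X,
      Polynomial.eval_one, Polynomial.eval_pow] at a b
    push_cast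
    rw [show (n : ℤ) + 1 + 1 = n + 2 by ring, a, b]
    refine ⟨by linear_combination h1, ?_, ?_⟩ <;> nlinarith [Nat.cast_nonneg (α := ℝ) n]

open Polynomial.Chebyshev in
theorem abs_var_sub_le (n : ℕ) : |var n - √2 / 4 * n| ≤ 1 := by
  obtain ⟨h1, h2, h3⟩ := pell_chebyshev n
  have h4 := congrArg (Polynomial.eval (3 : ℝ)) (add_one_mul_T_eq_poly_in_U (R := ℝ) n)
  simp only [Polynomial.eval_add, Polynomial.eval_sub, Polynomial.eval_mul, Polynomial.eval_X,
      Polynomial.eval_one, Polynomial.eval_pow, eval_derivative_U_three] at h4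
  set t := (T ℝ (n + 1)).eval 3
  set u := (U ℝ n).eval 3
  set s := √2 with hs
  have hs2 : s ^ 2 = 2 := Real.sq_sqrt (by norm_num)
  have hs1 : 1 ≤ s := by rw [hs]; exact Real.one_le_sqrt.2 (by norm_num)
  have hs3 : s ≤ 2 := by nlinarith
  have hn : (0 : ℝ) ≤ n := Nat.cast_nonneg n
  -- The derivative formula expresses `var n` through the quotient `t / u`.
  have h5 : (n + 1) * t = (3 + 8 * var n) * u := by
    simp at h4
    linarith
  have hu : 0 < u := by linarith
  -- The Pell equation factors as follows, so `t / u` is close to `2√2`.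
  have hst : (t - 2 * s * u) * (t + 2 * s * u) = 1 := by
    linear_combination h1 - 4 * u ^ 2 * hs2
  have hpos : 0 < t + 2 * s * u := by positivity
  have hlo : 0 ≤ t - 2 * s * u := by
    by_contra! h
    nlinarith
  have hhi : (n + 1) * (t - 2 * s * u) ≤ u := by
    have : (t - 2 * s * u) * (2 * s * u) ≤ 1 := by nlinarith
    have : (t - 2 * s * u) * u ≤ 1 := by nlinarith [mul_nonneg hlo hu.le]
    have : (t - 2 * s * u) * (n + 1) ≤ 1 := by nlinarith
    nlinarith
  have e : 8 * (var n - s / 4 * n) * u = (n + 1) * (t - 2 * s * u) + (2 * s - 3) * u := by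
    linear_combination -h5
  have lo : 0 ≤ (n + 1) * (t - 2 * s * u) := by positivity
  rw [abs_le]
  constructor
  · by_contra! h
    nlinarith
  · by_contra! h
    nlinarith

theorem var_isEquivalent :
    Asymptotics.IsEquivalent atTop var (fun n : ℕ => √2 / 4 * (n : ℝ)) := by
  refine Asymptotics.IsBigO.trans_isLittleO (g := fun _ : ℕ => (1 : ℝ)) ?_ ?_
  · exact Asymptotics.IsBigO.of_bound 1 (Eventually.of_forall fun n => by
      simpa using abs_var_sub_le n)
  · rw [Asymptotics.isLittleO_const_left]
    right
    have : Tendsto (fun n : ℕ => √2 / 4 * (n : ℝ)) atTop atTop :=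
      tendsto_natCast_atTop_atTop.const_mul_atTop (by positivity)
    exact tendsto_norm_atTop_atTop.comp this

/-! ### The characteristic function -/

/-- The characteristic function of `p(n, ·)` recentred at its mean `n`; it is real because the
quadratic factors of the sextet polynomial are palindromic. -/
def chi (n : ℕ) (t : ℝ) : ℝ := ∏ k ∈ Finset.range n, (1 - (1 - Real.cos t) / (3 - node n k))

open Polynomial in
theorem eval_exp_sextetPoly (n : ℕ) (t : ℝ) :
    (sextetPoly n).eval₂ (algebraMap ℝ ℂ) (Complex.exp (t * Complex.I)) =
      Complex.exp (t * Complex.I) ^ n * ((sextetPoly n).eval 1 * chi n t : ℝ) := by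
  rw [sextetPoly_eq_prod, eval₂_finsetProd, eval_prod, chi, ← Finset.prod_mul_distrib]
  have h : Complex.exp (t * Complex.I) ^ n =
    ∏ _k ∈ Finset.range n, Complex.exp (t * Complex.I) := by simp
  rw [h, Complex.ofReal_prod, ← Finset.prod_mul_distrib]
  refine Finset.prod_congr rfl fun k _ => ?_
  have hc : 2 * (Real.cos t : ℂ) * Complex.exp (t * Complex.I) =
      Complex.exp (t * Complex.I) ^ 2 + 1 := by
    rw [Complex.ofReal_cos, Complex.two_cos, add_mul, ← Complex.exp_add, ← Complex.exp_add, sq,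
      ← Complex.exp_add]
    simp
  have hne : 3 - node n k ≠ 0 := by linarith [two_le_three_sub_node n k]
  have hr : (1 ^ 2 + (4 - 2 * node n k) * 1 + 1) * (1 - (1 - Real.cos t) / (3 - node n k)) =
      4 - 2 * node n k + 2 * Real.cos t := by
    field_simp
    ring
  simp only [eval₂_add, eval₂_mul, eval₂_pow, eval₂_X, eval₂_C, eval₂_one, eval_add, eval_mul,
    eval_pow, eval_X, eval_C, eval_one]
  rw [hr]
  simp only [Complex.coe_algebraMap]
  push_cast at hc ⊢
  linear_combination -hc

theorem sum_coeff_mul_cos (n : ℕ) (m : ℤ) (t : ℝ) :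
    ∑ k ∈ Finset.range ((sextetPoly n).natDegree + 1),
        (sextetPoly n).coeff k * Real.cos (((k : ℝ) - m) * t) =
      (sextetPoly n).eval 1 * (chi n t * Real.cos (((m : ℝ) - n) * t)) := by
  have h := eval_exp_sextetPoly n t
  rw [Polynomial.eval₂_eq_sum_range] at h
  have h2 := congrArg (fun z => (z * Complex.exp (((-m * t : ℝ) : ℂ) * Complex.I)).re) h
  have e : ∀ k : ℕ, Complex.exp (t * Complex.I) ^ k * Complex.exp (((-m * t : ℝ) : ℂ) * Complex.I)
      = Complex.exp (((((k : ℝ) - m) * t : ℝ) : ℂ) * Complex.I) := by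
    intro k
    rw [← Complex.exp_nat_mul, ← Complex.exp_add]
    congr 1
    push_cast
    ring
  simp only [Finset.sum_mul, mul_assoc, e, Complex.re_sum, Complex.coe_algebraMap,
    Complex.re_ofReal_mul, Complex.exp_ofReal_mul_I_re] at h2
  rw [h2, mul_left_comm, e, Complex.re_ofReal_mul, Complex.exp_ofReal_mul_I_re, mul_assoc,
    ← Real.cos_neg]
  ring_nf

theorem integral_cos_int_mul (j : ℤ) :
    ∫ t in (-Real.pi)..Real.pi, Real.cos ((j : ℝ) * t) = if j = 0 then 2 * Real.pi else 0 := by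
  split_ifs with h
  · simp [h]; ring
  · have hj : (j : ℝ) ≠ 0 := Int.cast_ne_zero.2 h
    rw [intervalIntegral.integral_comp_mul_left _ hj, integral_cos]
    simp [Real.sin_int_mul_pi]

theorem continuous_chi (n : ℕ) : Continuous (chi n) := by
  unfold chi
  fun_prop

/-- Fourier inversion. -/
theorem normalizedProb_eq_integral (n : ℕ) (m : ℤ) :
    normalizedProb pyreneNumber n m = 1 / (2 * Real.pi) *
      ∫ t in (-Real.pi)..Real.pi, chi n t * Real.cos (((m : ℝ) - n) * t) := by
  obtain ⟨h0, -, -⟩ := sextetPoly_moments n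
  have h : ∫ t in (-Real.pi)..Real.pi, ∑ k ∈ Finset.range ((sextetPoly n).natDegree + 1),
      (sextetPoly n).coeff k * Real.cos (((k : ℝ) - m) * t) =
      2 * Real.pi * ((sextetPoly n).eval 1 * normalizedProb pyreneNumber n m) := by
    rw [intervalIntegral.integral_finsetSum fun k _ =>
      Continuous.intervalIntegrable (by fun_prop) _ _]
    have e : ∀ k : ℕ, ∫ t in (-Real.pi)..Real.pi,
        (sextetPoly n).coeff k * Real.cos (((k : ℝ) - m) * t) =
        if (k : ℤ) = m then 2 * Real.pi * (sextetPoly n).coeff k else 0 := by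
      intro k
      have := integral_cos_int_mul ((k : ℤ) - m)
      push_cast at this
      rw [intervalIntegral.integral_const_mul, this]
      simp only [sub_eq_zero]
      split_ifs <;> ring
    simp only [e]
    rcases lt_or_ge m 0 with hm | hm
    · rw [normalizedProb_of_neg n hm]
      simp only [mul_zero]
      exact Finset.sum_eq_zero fun k _ => if_neg (by omega)
    · lift m to ℕ using hm
      rw [normalizedProb_natCast, mul_div_cancel₀ _ h0.ne']
      simp only [Nat.cast_inj, Finset.sum_ite_eq', Finset.mem_range]
      split_ifs with hk
      · rfl
      · rw [Polynomial.coeff_eq_zero_of_natDegree_lt (by omega), mul_zero]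
  simp only [sum_coeff_mul_cos, intervalIntegral.integral_const_mul] at h
  have h3 : ∫ t in (-Real.pi)..Real.pi, chi n t * Real.cos (((m : ℝ) - n) * t) =
      2 * Real.pi * normalizedProb pyreneNumber n m := by
    apply mul_left_cancel₀ h0.ne'
    rw [h]; ring
  rw [h3]
  field_simp

/-- Products of numbers of `[0, 1]` differ by at most the sum of the differences. -/
theorem abs_prod_sub_prod_le {ι : Type*} (s : Finset ι) (f g : ι → ℝ)
    (hf : ∀ k ∈ s, 0 ≤ f k ∧ f k ≤ 1) (hg : ∀ k ∈ s, 0 ≤ g k ∧ g k ≤ 1) :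
    |∏ k ∈ s, f k - ∏ k ∈ s, g k| ≤ ∑ k ∈ s, |f k - g k| := by
  classical
  induction s using Finset.induction_on with
  | empty => simp
  | insert a s ha ih =>
    rw [Finset.prod_insert ha, Finset.prod_insert ha, Finset.sum_insert ha]
    have hf' := fun k hk => hf k (Finset.mem_insert_of_mem hk)
    have hg' := fun k hk => hg k (Finset.mem_insert_of_mem hk)
    have h1 : 0 ≤ ∏ k ∈ s, f k := Finset.prod_nonneg fun k hk => (hf' k hk).1
    have h2 : ∏ k ∈ s, f k ≤ 1 := Finset.prod_le_one (fun k hk => (hf' k hk).1)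
      fun k hk => (hf' k hk).2
    obtain ⟨g0, g1⟩ := hg a (Finset.mem_insert_self _ _)
    have e : f a * ∏ k ∈ s, f k - g a * ∏ k ∈ s, g k =
        (f a - g a) * ∏ k ∈ s, f k + g a * (∏ k ∈ s, f k - ∏ k ∈ s, g k) := by ring
    rw [e]
    refine (abs_add_le _ _).trans (add_le_add ?_ ?_)
    · rw [abs_mul, abs_of_nonneg h1]
      exact mul_le_of_le_one_right (abs_nonneg _) h2
    · rw [abs_mul, abs_of_nonneg g0]
      exact (mul_le_of_le_one_left (abs_nonneg _) g1).trans (ih hf' hg')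

theorem factor_mem (n k : ℕ) (t : ℝ) : 0 ≤ (1 - Real.cos t) / (3 - node n k) ∧
    (1 - Real.cos t) / (3 - node n k) ≤ 1 ∧
    (1 - Real.cos t) / (3 - node n k) ≤ t ^ 2 / 4 := by
  have h := two_le_three_sub_node n k
  have h1 := Real.cos_le_one t
  have h2 := Real.neg_one_le_cos t
  have h3 := Real.one_sub_sq_div_two_le_cos (x := t)
  refine ⟨div_nonneg (by linarith) (by linarith), (div_le_one (by linarith)).2 (by linarith), ?_⟩
  rw [div_le_iff₀ (by linarith)]
  nlinarith [sq_nonneg t]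

theorem exp_var_eq_prod (n : ℕ) (t : ℝ) : Real.exp (-(var n * (1 - Real.cos t))) =
    ∏ k ∈ Finset.range n, Real.exp (-((1 - Real.cos t) / (3 - node n k))) := by
  rw [← Real.exp_sum, var, Finset.sum_mul, Finset.sum_neg_distrib]
  congr 2
  exact Finset.sum_congr rfl fun k _ => by ring

theorem chi_nonneg (n : ℕ) (t : ℝ) : 0 ≤ chi n t :=
  Finset.prod_nonneg fun k _ => by linarith [(factor_mem n k t).2.1]

theorem chi_le (n : ℕ) {t : ℝ} (ht : |t| ≤ Real.pi) :
    chi n t ≤ Real.exp (-(2 / Real.pi ^ 2) * (var n * t ^ 2)) := by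
  calc chi n t ≤ Real.exp (-(var n * (1 - Real.cos t))) := by
        rw [exp_var_eq_prod]
        refine Finset.prod_le_prod (fun k _ => by linarith [(factor_mem n k t).2.1]) fun k _ => ?_
        linarith [Real.add_one_le_exp (-((1 - Real.cos t) / (3 - node n k)))]
    _ ≤ _ := by
        have h0 : 0 ≤ var n := le_trans (by positivity) (le_var n)
        have h := Real.cos_le_one_sub_mul_cos_sq ht
        refine Real.exp_le_exp.2 ?_
        nlinarith

theorem abs_chi_sub_le (n : ℕ) (t : ℝ) :
    |chi n t - Real.exp (-(var n * (1 - Real.cos t)))| ≤ n * (t ^ 2 / 4) ^ 2 := by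
  rw [exp_var_eq_prod, chi]
  refine (abs_prod_sub_prod_le _ _ _ (fun k _ => ?_) fun k _ => ⟨(Real.exp_pos _).le, ?_⟩).trans ?_
  · obtain ⟨h1, h2, -⟩ := factor_mem n k t
    constructor <;> linarith
  · rw [Real.exp_le_one_iff]
    linarith [(factor_mem n k t).1]
  · refine (Finset.sum_le_card_nsmul _ _ ((t ^ 2 / 4) ^ 2) fun k _ => ?_).trans ?_
    · obtain ⟨h1, h2, h3⟩ := factor_mem n k t
      set y := (1 - Real.cos t) / (3 - node n k)
      have := Real.abs_exp_sub_one_sub_id_le (x := -y) (by rwa [abs_neg, abs_of_nonneg h1])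
      rw [abs_sub_comm]
      calc |Real.exp (-y) - (1 - y)| = |Real.exp (-y) - 1 - -y| := by congr 1; ring
        _ ≤ (-y) ^ 2 := this
        _ ≤ _ := by rw [neg_sq]; gcongr
    · simp

open MeasureTheory

/-! ### The local limit theorem -/

/-- The standard normal density. -/
def gauss (x : ℝ) : ℝ := 1 / √(2 * Real.pi) * Real.exp (-x ^ 2 / 2)

/-- The standard deviation of `p(n, ·)`. -/
def sd (n : ℕ) : ℝ := √(var n)

theorem seqStdDev_pyreneNumber (n : ℕ) : seqStdDev pyreneNumber n = sd n := by
  rw [seqStdDev, seqVariance_pyreneNumber, sd]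

theorem var_pos {n : ℕ} (hn : 0 < n) : 0 < var n :=
  lt_of_lt_of_le (by positivity) (le_var n)

theorem sd_pos {n : ℕ} (hn : 0 < n) : 0 < sd n := Real.sqrt_pos.2 (var_pos hn)

theorem sd_sq (n : ℕ) : sd n ^ 2 = var n :=
  Real.sq_sqrt (le_trans (by positivity) (le_var n))

theorem tendsto_var : Tendsto var atTop atTop :=
  tendsto_atTop_mono le_var (tendsto_natCast_atTop_atTop.atTop_div_const (by norm_num))

theorem tendsto_sd : Tendsto sd atTop atTop := Real.tendsto_sqrt_atTop.comp tendsto_var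

/-- The characteristic function of the standardised distribution, cut off at the ends of its
period. -/
def psi (n : ℕ) (u : ℝ) : ℝ :=
  (Set.Ioc (-Real.pi * sd n) (Real.pi * sd n)).indicator (fun u => chi n (u / sd n)) u

theorem measurable_psi (n : ℕ) : Measurable (psi n) :=
  Measurable.indicator (by have := continuous_chi n; fun_prop) measurableSet_Ioc

theorem integrable_exp_neg_sq_div_two : Integrable fun u : ℝ => Real.exp (-u ^ 2 / 2) := by
  convert! integrable_exp_neg_mul_sq (b := 1 / 2) (by norm_num) using 3
  ring

/-- The real form of the Fourier transform of the Gaussian. -/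
theorem integral_exp_mul_cos (y : ℝ) :
    ∫ u : ℝ, Real.exp (-u ^ 2 / 2) * Real.cos (y * u) =
      √(2 * Real.pi) * Real.exp (-y ^ 2 / 2) := by
  have h := fourierIntegral_gaussian (b := 1 / 2) (by norm_num) (y : ℂ)
  have e : ∀ x : ℝ, Complex.exp (Complex.I * y * x) * Complex.exp (-(1 / 2) * x ^ 2) =
      (Real.exp (-x ^ 2 / 2) : ℝ) * Complex.exp ((y * x : ℝ) * Complex.I) := by
    intro x
    rw [mul_comm]
    push_cast
    ring_nf
  have hr : ((Real.pi : ℂ) / (1 / 2)) ^ (1 / 2 : ℂ) * Complex.exp (-(y : ℂ) ^ 2 / (4 * (1 / 2))) =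
      ((√(2 * Real.pi) * Real.exp (-y ^ 2 / 2) : ℝ) : ℂ) := by
    rw [Real.sqrt_eq_rpow, Complex.ofReal_mul, Complex.ofReal_cpow (by positivity)]
    push_cast
    ring_nf
  simp only [e] at h
  rw [hr] at h
  have hint : Integrable fun x : ℝ =>
      ((Real.exp (-x ^ 2 / 2) : ℝ) : ℂ) * Complex.exp ((y * x : ℝ) * Complex.I) := by
    refine integrable_exp_neg_sq_div_two.ofReal.mul_bdd (c := 1)
      (by fun_prop) (Eventually.of_forall fun x => ?_)
    rw [Complex.norm_exp_ofReal_mul_I]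
  have h2 := congrArg Complex.re h
  rw [Complex.ofReal_re, ← Complex.reCLM_apply, ← ContinuousLinearMap.integral_comp_comm _ hint]
    at h2
  rw [← h2]
  refine integral_congr_ae (Eventually.of_forall fun x => ?_)
  simp only [Complex.reCLM_apply, Complex.re_ofReal_mul, Complex.exp_ofReal_mul_I_re]

theorem psi_nonneg (n : ℕ) (u : ℝ) : 0 ≤ psi n u :=
  Set.indicator_nonneg (fun _ _ => chi_nonneg n _) u

theorem psi_le {n : ℕ} (hn : 0 < n) (u : ℝ) :
    psi n u ≤ Real.exp (-(2 / Real.pi ^ 2) * u ^ 2) := by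
  rw [psi, Set.indicator_apply]
  split_ifs with hu
  swap
  · exact (Real.exp_pos _).le
  have hs := sd_pos hn
  have h : |u / sd n| ≤ Real.pi := by
    rw [abs_div, abs_of_pos hs, div_le_iff₀ hs, abs_le]
    exact ⟨by linarith [hu.1], hu.2⟩
  refine (chi_le n h).trans_eq ?_
  rw [← sd_sq, div_pow, mul_div_cancel₀ _ (pow_pos hs 2).ne']

/-- The `L¹` distance between `psi n` and the characteristic function of the standard normal law. -/
def charError (n : ℕ) : ℝ := ∫ u : ℝ, |psi n u - Real.exp (-u ^ 2 / 2)|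

theorem integrable_psi {n : ℕ} (hn : 0 < n) : Integrable (psi n) := by
  refine (integrable_exp_neg_mul_sq (b := 2 / Real.pi ^ 2) (by positivity)).mono'
    (measurable_psi n).aestronglyMeasurable (Eventually.of_forall fun u => ?_)
  rw [Real.norm_of_nonneg (psi_nonneg n u)]
  exact psi_le hn u

theorem normalizedProb_eq_integral_psi {n : ℕ} (hn : 0 < n) (m : ℤ) :
    sd n * normalizedProb pyreneNumber n m =
      1 / (2 * Real.pi) * ∫ u : ℝ, psi n u * Real.cos (((m : ℝ) - n) / sd n * u) := by
  have hs := sd_pos hn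
  have hle : -Real.pi * sd n ≤ Real.pi * sd n := by nlinarith [Real.pi_pos]
  have e : ∀ u, psi n u * Real.cos (((m : ℝ) - n) / sd n * u) =
      (Set.Ioc (-Real.pi * sd n) (Real.pi * sd n)).indicator
        (fun u => chi n (u / sd n) * Real.cos (((m : ℝ) - n) * (u / sd n))) u := by
    intro u
    simp only [psi, Set.indicator_apply]
    split_ifs
    · congr 2
      ring
    · rw [zero_mul]
  simp only [e]
  rw [integral_indicator measurableSet_Ioc, ← intervalIntegral.integral_of_le hle,
    intervalIntegral.integral_comp_div (fun t => chi n t * Real.cos (((m : ℝ) - n) * t)) hs.ne',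
    mul_div_cancel_right₀ _ hs.ne', mul_div_cancel_right₀ _ hs.ne', normalizedProb_eq_integral,
    smul_eq_mul]
  ring

/-- The local limit theorem at lattice points, with a bound independent of the point. -/
theorem abs_sub_gauss_le {n : ℕ} (hn : 0 < n) (m : ℤ) :
    |sd n * normalizedProb pyreneNumber n m - gauss (((m : ℝ) - n) / sd n)| ≤ charError n := by
  set y := ((m : ℝ) - n) / sd n with hy
  have hg : gauss y = 1 / (2 * Real.pi) * ∫ u : ℝ, Real.exp (-u ^ 2 / 2) * Real.cos (y * u) := by
    rw [integral_exp_mul_cos, gauss]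
    have h : √(2 * Real.pi) ≠ 0 := by positivity
    have h2 : √(2 * Real.pi) ^ 2 = 2 * Real.pi := Real.sq_sqrt (by positivity)
    set r := √(2 * Real.pi)
    clear_value r
    rw [← h2]
    field_simp
  have hb : ∀ u : ℝ, ‖Real.cos (y * u)‖ ≤ 1 := fun u => Real.abs_cos_le_one _
  have i1 : Integrable fun u => psi n u * Real.cos (y * u) :=
    (integrable_psi hn).mul_bdd (c := 1) (by fun_prop) (Eventually.of_forall hb)
  have i2 : Integrable fun u : ℝ => Real.exp (-u ^ 2 / 2) * Real.cos (y * u) :=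
    integrable_exp_neg_sq_div_two.mul_bdd (c := 1) (by fun_prop) (Eventually.of_forall hb)
  rw [normalizedProb_eq_integral_psi hn, hg, ← mul_sub, ← integral_sub i1 i2, abs_mul]
  have hpi : |1 / (2 * Real.pi)| ≤ 1 := by
    rw [abs_of_pos (by positivity), div_le_one (by positivity)]
    linarith [Real.pi_gt_three]
  refine (mul_le_of_le_one_left (abs_nonneg _) hpi).trans ?_
  refine abs_integral_le_integral_abs.trans (integral_mono (i1.sub i2).abs
    ((integrable_psi hn).sub integrable_exp_neg_sq_div_two).abs fun u => ?_)
  dsimp only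
  rw [← sub_mul, abs_mul]
  exact mul_le_of_le_one_right (abs_nonneg _) (hb u)

theorem tendsto_psi (u : ℝ) :
    Tendsto (fun n => psi n u) atTop (𝓝 (Real.exp (-u ^ 2 / 2))) := by
  have hsd : ∀ᶠ n in atTop, |u| + 1 ≤ sd n := tendsto_sd.eventually_ge_atTop _
  -- The exponent `var n * (1 - cos (u / sd n))` tends to `u ^ 2 / 2`.
  have h1 : Tendsto (fun n => var n * (1 - Real.cos (u / sd n))) atTop (𝓝 (u ^ 2 / 2)) := by
    rw [tendsto_iff_norm_sub_tendsto_zero]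
    refine squeeze_zero' (Eventually.of_forall fun n => norm_nonneg _)
      (g := fun n => u ^ 4 * (5 / 96) / var n) ?_ (tendsto_const_nhds.div_atTop tendsto_var)
    filter_upwards [hsd, eventually_gt_atTop 0] with n hn hn0
    have hs := sd_pos hn0
    have hx : |u / sd n| ≤ 1 := by
      rw [abs_div, abs_of_pos hs, div_le_one hs]; linarith
    have hb := Real.cos_bound hx
    have e : var n * (1 - Real.cos (u / sd n)) - u ^ 2 / 2 =
        -(var n * (Real.cos (u / sd n) - (1 - (u / sd n) ^ 2 / 2))) := by
      rw [← sd_sq]; field_simp; ring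
    rw [Real.norm_eq_abs, e, abs_neg, abs_mul, abs_of_pos (var_pos hn0)]
    calc var n * |Real.cos (u / sd n) - (1 - (u / sd n) ^ 2 / 2)|
        ≤ var n * (|u / sd n| ^ 4 * (5 / 96)) := by have := var_pos hn0; gcongr
      _ = u ^ 4 * (5 / 96) / var n := by
        rw [← sd_sq, abs_div, abs_of_pos hs, div_pow, Even.pow_abs (by decide)]
        field_simp
  have h2 : Tendsto (fun n => Real.exp (-(var n * (1 - Real.cos (u / sd n))))) atTop
      (𝓝 (Real.exp (-u ^ 2 / 2))) := by
    have := (Real.continuous_exp.tendsto _).comp h1.neg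
    rwa [← neg_div] at this
  have h3 : Tendsto (fun n => chi n (u / sd n) -
      Real.exp (-(var n * (1 - Real.cos (u / sd n))))) atTop (𝓝 0) := by
    rw [tendsto_zero_iff_norm_tendsto_zero]
    refine squeeze_zero' (Eventually.of_forall fun n => norm_nonneg _)
      (g := fun n : ℕ => u ^ 4 / (n : ℝ)) ?_
      (tendsto_const_nhds.div_atTop tendsto_natCast_atTop_atTop)
    filter_upwards [eventually_gt_atTop 0] with n hn0
    refine (abs_chi_sub_le n _).trans ?_
    have hn : (0 : ℝ) < n := Nat.cast_pos.2 hn0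
    have hv := le_var n
    rw [div_pow u, sd_sq]
    calc (n : ℝ) * (u ^ 2 / var n / 4) ^ 2 ≤ n * (u ^ 2 / (n / 4) / 4) ^ 2 := by
          have := var_pos hn0
          gcongr
      _ = u ^ 4 / n := by field_simp
  have h4 := h3.add h2
  simp only [sub_add_cancel, zero_add] at h4
  refine h4.congr' ?_
  filter_upwards [hsd, eventually_gt_atTop 0] with n hn hn0
  have hs := sd_pos hn0
  have hu := abs_le.1 (show |u| ≤ sd n - 1 by linarith)
  have := Real.pi_gt_three
  rw [psi, Set.indicator_of_mem]
  constructor <;> nlinarith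

/-- Dominated convergence, with the Gaussian bound `psi_le`. -/
theorem tendsto_charError : Tendsto charError atTop (𝓝 0) := by
  have h := tendsto_integral_filter_of_dominated_convergence (μ := volume) (l := atTop)
    (F := fun (n : ℕ) (u : ℝ) => |psi n u - Real.exp (-u ^ 2 / 2)|) (f := fun _ => 0)
    (fun u => Real.exp (-(2 / Real.pi ^ 2) * u ^ 2) + Real.exp (-u ^ 2 / 2)) ?_ ?_ ?_ ?_
  · simp only [integral_zero] at h
    exact h
  · exact Eventually.of_forall fun n => by
      have := measurable_psi n
      fun_prop
  · filter_upwards [eventually_gt_atTop 0] with n hn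
    refine Eventually.of_forall fun u => ?_
    rw [Real.norm_eq_abs, abs_abs]
    refine (abs_sub _ _).trans ?_
    rw [abs_of_nonneg (psi_nonneg n u), abs_of_pos (Real.exp_pos _)]
    gcongr
    exact psi_le hn u
  · exact (integrable_exp_neg_mul_sq (by positivity)).add integrable_exp_neg_sq_div_two
  · refine Eventually.of_forall fun u => ?_
    have := ((tendsto_psi u).sub_const (Real.exp (-u ^ 2 / 2))).abs
    simpa using this

theorem gauss_nonneg (x : ℝ) : 0 ≤ gauss x := by unfold gauss; positivity

theorem one_div_sqrt_le : 1 / √(2 * Real.pi) ≤ 1 := by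
  rw [div_le_one (by positivity), Real.one_le_sqrt]
  linarith [Real.pi_gt_three]

theorem gauss_le_one (x : ℝ) : gauss x ≤ 1 := by
  refine mul_le_one₀ one_div_sqrt_le (Real.exp_pos _).le ?_
  rw [Real.exp_le_one_iff]
  linarith [sq_nonneg x]

theorem abs_gauss_sub_le (x y : ℝ) : |gauss x - gauss y| ≤ |x - y| := by
  have hd : ∀ x : ℝ, HasDerivAt gauss (1 / √(2 * Real.pi) * (Real.exp (-x ^ 2 / 2) * (-x))) x := by
    intro x
    have h1 : HasDerivAt (fun x : ℝ => -x ^ 2 / 2) (-x) x := by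
      have := ((hasDerivAt_pow 2 x).neg).div_const 2
      convert! this using 1
      simp
      ring
    exact (h1.exp).const_mul _
  have hb : ∀ x ∈ Set.univ, ‖1 / √(2 * Real.pi) * (Real.exp (-x ^ 2 / 2) * (-x))‖ ≤ 1 := by
    intro x _
    rw [norm_mul, norm_mul, norm_neg, Real.norm_of_nonneg (by positivity),
      Real.norm_of_nonneg (Real.exp_pos _).le, Real.norm_eq_abs]
    refine mul_le_one₀ one_div_sqrt_le (by positivity) ?_
    rw [neg_div, Real.exp_neg, inv_mul_le_one₀ (Real.exp_pos _)]
    have := Real.add_one_le_exp (x ^ 2 / 2)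
    nlinarith [sq_nonneg (|x| - 1), sq_abs x]
  have h := Convex.norm_image_sub_le_of_norm_hasDerivWithin_le
    (fun x _ => (hd x).hasDerivWithinAt) hb convex_univ (Set.mem_univ y) (Set.mem_univ x)
  simpa using h

/-- Rounding `n + x * sd n` down to a lattice point moves `x` by at most `1 / sd n`. -/
theorem abs_sub_gauss_floor_le {n : ℕ} (hn : 0 < n) (x : ℝ) :
    |sd n * normalizedProb pyreneNumber n ⌊n + x * sd n⌋ - gauss x| ≤
      charError n + 1 / sd n := by
  have hs := sd_pos hn
  set m := ⌊n + x * sd n⌋ with hm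
  have h1 := abs_sub_gauss_le hn m
  have h2 := abs_gauss_sub_le (((m : ℝ) - n) / sd n) x
  have h3 : |((m : ℝ) - n) / sd n - x| ≤ 1 / sd n := by
    rw [div_sub' hs.ne', abs_div, abs_of_pos hs]
    gcongr
    have a := Int.floor_le (n + x * sd n)
    have b := Int.lt_floor_add_one (n + x * sd n)
    rw [← hm] at a b
    rw [abs_le]
    constructor <;> linarith
  exact (abs_sub_le _ _ _).trans (add_le_add h1 (h2.trans h3))

theorem tendsto_error : Tendsto (fun n => charError n + 1 / sd n) atTop (𝓝 0) := by
  have := tendsto_charError.add (tendsto_const_nhds (x := (1 : ℝ)).div_atTop tendsto_sd)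
  simpa using this

/-- A uniform bound tending to zero gives convergence to zero of the suprema. -/
theorem tendsto_iSup_ofReal_zero {f : ℕ → ℝ → ℝ} {e : ℕ → ℝ} (he : Tendsto e atTop (𝓝 0))
    (h : ∀ᶠ n in atTop, ∀ x, f n x ≤ e n) :
    Tendsto (fun n => ⨆ x : ℝ, ENNReal.ofReal (f n x)) atTop (𝓝 0) := by
  have he' := (ENNReal.continuous_ofReal.tendsto _).comp he
  rw [ENNReal.ofReal_zero] at he'
  refine tendsto_of_tendsto_of_tendsto_of_le_of_le' tendsto_const_nhds he'
    (Eventually.of_forall fun n => zero_le) ?_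
  filter_upwards [h] with n hn
  exact iSup_le fun x => ENNReal.ofReal_le_ofReal (hn x)

theorem asymptoticallyNormalLLT_pyreneNumber : AsymptoticallyNormalLLT pyreneNumber := by
  refine tendsto_iSup_ofReal_zero tendsto_error ?_
  filter_upwards [eventually_gt_atTop 0] with n hn x
  rw [seqStdDev_pyreneNumber, seqMean_pyreneNumber]
  exact abs_sub_gauss_floor_le hn x

/-! ### The central limit theorem -/

theorem integrable_gauss : Integrable gauss := integrable_exp_neg_sq_div_two.const_mul _

theorem integral_gauss : ∫ x, gauss x = 1 := by
  have h := integral_exp_mul_cos 0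
  simp only [zero_mul, Real.cos_zero, mul_one] at h
  simp only [gauss]
  rw [integral_const_mul, h]
  have : √(2 * Real.pi) ≠ 0 := by positivity
  field_simp
  simp

/-- The density of the standardised distribution `p(n, ·)`, spread out evenly between consecutive
lattice points. -/
def stepDensity (n : ℕ) (x : ℝ) : ℝ := sd n * normalizedProb pyreneNumber n ⌊n + x * sd n⌋

theorem stepDensity_nonneg (n : ℕ) (x : ℝ) : 0 ≤ stepDensity n x :=
  mul_nonneg (Real.sqrt_nonneg _) (normalizedProb_nonneg n _)

theorem stepDensity_eq_sum {n : ℕ} (hn : 0 < n) (x : ℝ) : stepDensity n x =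
    ∑ k ∈ Finset.range ((sextetPoly n).natDegree + 1),
      (Set.Ico (((k : ℝ) - n) / sd n) (((k : ℝ) + 1 - n) / sd n)).indicator
        (fun _ => sd n * normalizedProb pyreneNumber n k) x := by
  have hs := sd_pos hn
  have e : ∀ k : ℕ, (Set.Ico (((k : ℝ) - n) / sd n) (((k : ℝ) + 1 - n) / sd n)).indicator
        (fun _ => sd n * normalizedProb pyreneNumber n k) x =
      if ⌊n + x * sd n⌋ = (k : ℤ) then sd n * normalizedProb pyreneNumber n k else 0 := by
    intro k
    rw [Set.indicator_apply]
    refine if_congr ?_ rfl rfl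
    rw [Set.mem_Ico, div_le_iff₀ hs, lt_div_iff₀ hs, Int.floor_eq_iff]
    push_cast
    constructor <;> rintro ⟨h1, h2⟩ <;> constructor <;> linarith
  simp only [e, stepDensity]
  generalize ⌊n + x * sd n⌋ = m
  rcases lt_or_ge m 0 with hm | hm
  · rw [normalizedProb_of_neg n hm, mul_zero]
    exact (Finset.sum_eq_zero fun k _ => if_neg (by omega)).symm
  · lift m to ℕ using hm
    simp only [Nat.cast_inj, Finset.sum_ite_eq, Finset.mem_range]
    split_ifs with hk
    · rfl
    · rw [normalizedProb_natCast, Polynomial.coeff_eq_zero_of_natDegree_lt (by omega), zero_div,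
        mul_zero]

theorem integrable_stepDensity_term (n k : ℕ) (c : ℝ) : Integrable
    ((Set.Ico (((k : ℝ) - n) / sd n) (((k : ℝ) + 1 - n) / sd n)).indicator fun _ => c) :=
  (integrable_indicator_iff measurableSet_Ico).2 (integrableOn_const (by simp))

theorem integrable_stepDensity {n : ℕ} (hn : 0 < n) : Integrable (stepDensity n) := by
  rw [funext (stepDensity_eq_sum hn)]
  exact integrable_finsetSum _ fun k _ => integrable_stepDensity_term n k _

/-- Below the lattice point that follows `J`, the step density has mass `∑ k ≤ J, p(n, k)`. -/
theorem setIntegral_stepDensity {n : ℕ} (hn : 0 < n) (J : ℤ) :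
    ∫ x in Set.Iio (((J : ℝ) + 1 - n) / sd n), stepDensity n x =
      ∑' k : ℕ, if (k : ℤ) ≤ J then normalizedProb pyreneNumber n k else 0 := by
  have hs := sd_pos hn
  rw [funext (stepDensity_eq_sum hn)]
  rw [integral_finsetSum _ fun k _ => (integrable_stepDensity_term n k _).integrableOn]
  rw [tsum_eq_sum (s := Finset.range ((sextetPoly n).natDegree + 1))]
  · refine Finset.sum_congr rfl fun k _ => ?_
    rw [setIntegral_indicator measurableSet_Ico, setIntegral_const, smul_eq_mul]
    split_ifs with hk
    · have hk' : (k : ℝ) ≤ J := by exact_mod_cast hk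
      rw [Set.inter_eq_right.2, Real.volume_real_Ico_of_le]
      · field_simp
        ring
      · gcongr; linarith
      · intro x hx
        refine lt_of_lt_of_le hx.2 ?_
        gcongr
    · have hk' : (J : ℝ) + 1 ≤ k := by exact_mod_cast (by omega : J + 1 ≤ k)
      rw [Set.disjoint_iff_inter_eq_empty.1]
      · simp
      · refine Set.disjoint_left.2 fun x hx hx' => ?_
        have h1 : ((J : ℝ) + 1 - n) / sd n ≤ ((k : ℝ) - n) / sd n := by gcongr
        exact absurd (hx'.1.trans_lt hx) (not_lt.2 h1)
  · intro k hk
    rw [Finset.mem_range] at hk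
    rw [normalizedProb_natCast, Polynomial.coeff_eq_zero_of_natDegree_lt (by omega), zero_div,
      ite_self]

theorem integral_stepDensity {n : ℕ} (hn : 0 < n) : ∫ x, stepDensity n x = 1 := by
  have hs := sd_pos hn
  rw [funext (stepDensity_eq_sum hn),
    integral_finsetSum _ fun k _ => integrable_stepDensity_term n k _]
  have e : ∀ k : ℕ, ∫ x, (Set.Ico (((k : ℝ) - n) / sd n) (((k : ℝ) + 1 - n) / sd n)).indicator
        (fun _ => sd n * normalizedProb pyreneNumber n k) x =
      normalizedProb pyreneNumber n k := by
    intro k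
    rw [integral_indicator measurableSet_Ico, setIntegral_const, smul_eq_mul,
      Real.volume_real_Ico_of_le (by gcongr; linarith)]
    field_simp
    ring
  rw [Finset.sum_congr rfl fun k _ => e k]
  simp only [normalizedProb_natCast]
  have h := Polynomial.eval_eq_sum_range (p := sextetPoly n) 1
  simp only [one_pow, mul_one] at h
  rw [← Finset.sum_div, ← h, div_self (sextetPoly_moments n).1.ne']

/-- Scheffé's argument: densities that converge pointwise to a density converge in `L¹`. -/
theorem tendsto_integral_abs_sub_gauss :
    Tendsto (fun n => ∫ x, |stepDensity n x - gauss x|) atTop (𝓝 0) := by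
  have hlim : ∀ x, Tendsto (fun n => stepDensity n x) atTop (𝓝 (gauss x)) := by
    intro x
    rw [tendsto_iff_norm_sub_tendsto_zero]
    refine squeeze_zero' (Eventually.of_forall fun n => norm_nonneg _) ?_ tendsto_error
    filter_upwards [eventually_gt_atTop 0] with n hn
    exact abs_sub_gauss_floor_le hn x
  have h : Tendsto (fun n => ∫ x, max (gauss x - stepDensity n x) 0) atTop
      (𝓝 (∫ _ : ℝ, (0 : ℝ))) := by
    refine tendsto_integral_filter_of_dominated_convergence gauss ?_ ?_ integrable_gauss ?_
    · filter_upwards [eventually_gt_atTop 0] with n hn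
      exact (integrable_gauss.sub (integrable_stepDensity hn)).pos_part.aestronglyMeasurable
    · refine Eventually.of_forall fun n => Eventually.of_forall fun x => ?_
      rw [Real.norm_of_nonneg (le_max_right _ _)]
      exact max_le (by linarith [stepDensity_nonneg n x]) (gauss_nonneg x)
    · refine Eventually.of_forall fun x => ?_
      have := ((hlim x).const_sub (gauss x)).max (tendsto_const_nhds (x := (0 : ℝ)))
      simpa using this
  rw [integral_zero] at h
  have h2 := h.const_mul 2
  rw [mul_zero] at h2
  refine h2.congr' ?_
  filter_upwards [eventually_gt_atTop 0] with n hn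
  have hi := integrable_stepDensity hn
  have e : ∀ x, |stepDensity n x - gauss x| =
      2 * max (gauss x - stepDensity n x) 0 + (stepDensity n x - gauss x) := by
    intro x
    rcases le_total (gauss x) (stepDensity n x) with h | h
    · rw [abs_of_nonneg (by linarith), max_eq_right (by linarith)]; ring
    · rw [abs_of_nonpos (by linarith), max_eq_left (by linarith)]; ring
  simp only [e]
  have i1 : Integrable fun x => 2 * max (gauss x - stepDensity n x) 0 :=
    (integrable_gauss.sub hi).pos_part.const_mul 2
  have i2 : Integrable fun x => stepDensity n x - gauss x := hi.sub integrable_gauss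
  rw [integral_add i1 i2,
    integral_const_mul, integral_sub hi integrable_gauss, integral_stepDensity hn, integral_gauss]
  ring

theorem asymptoticallyNormalCLT_pyreneNumber : AsymptoticallyNormalCLT pyreneNumber := by
  have hlim : Tendsto (fun n => (∫ x, |stepDensity n x - gauss x|) + 1 / sd n) atTop (𝓝 0) := by
    simpa using tendsto_integral_abs_sub_gauss.add
      ((tendsto_const_nhds (x := (1 : ℝ))).div_atTop tendsto_sd)
  refine tendsto_iSup_ofReal_zero hlim ?_
  filter_upwards [eventually_gt_atTop 0] with n hn x
  have hs := sd_pos hn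
  have hi := integrable_stepDensity hn
  rw [seqStdDev_pyreneNumber, seqMean_pyreneNumber]
  set J := ⌊n + x * sd n⌋ with hJ
  have a := Int.floor_le (n + x * sd n)
  have b := Int.lt_floor_add_one (n + x * sd n)
  rw [← hJ] at a b
  -- The step density has to be integrated up to the lattice point `y` that follows `x`.
  set y := ((J : ℝ) + 1 - n) / sd n with hy
  have hxy : x < y := by rw [hy, lt_div_iff₀ hs]; linarith
  have hyx : y - x ≤ 1 / sd n := by
    rw [hy, div_sub' hs.ne']
    gcongr
    linarith
  have e1 : (∑' k : ℕ, if (k : ℝ) ≤ n + x * sd n then normalizedProb pyreneNumber n k else 0) =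
      ∫ u in Set.Iio y, stepDensity n u := by
    rw [hy, setIntegral_stepDensity hn]
    refine tsum_congr fun k => if_congr ?_ rfl rfl
    rw [hJ, Int.le_floor, Int.cast_natCast]
  have e2 : 1 / √(2 * Real.pi) * ∫ t in Set.Iic x, Real.exp (-t ^ 2 / 2) =
      ∫ t in Set.Iic x, gauss t := by
    simp only [gauss]
    rw [integral_const_mul]
  have e3 : ∫ t in Set.Iio y, gauss t =
      (∫ t in Set.Iic x, gauss t) + ∫ t in Set.Ioo x y, gauss t := by
    rw [← Set.Iic_union_Ioo_eq_Iio hxy, setIntegral_union _ measurableSet_Ioo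
      integrable_gauss.integrableOn integrable_gauss.integrableOn]
    exact Set.disjoint_left.2 fun t h1 h2 => absurd h2.1 (not_lt.2 h1)
  have h4 : |∫ t in Set.Ioo x y, gauss t| ≤ 1 / sd n := by
    have := norm_setIntegral_le_of_norm_le_const (μ := volume) (s := Set.Ioo x y) (C := 1)
      (f := gauss) (by simp) fun t _ => by
        rw [Real.norm_of_nonneg (gauss_nonneg t)]; exact gauss_le_one t
    rw [Real.volume_real_Ioo_of_le hxy.le, one_mul] at this
    exact this.trans hyx
  have h5 : |(∫ u in Set.Iio y, stepDensity n u) - ∫ t in Set.Iio y, gauss t| ≤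
      ∫ u, |stepDensity n u - gauss u| := by
    rw [← integral_sub hi.integrableOn integrable_gauss.integrableOn]
    exact abs_integral_le_integral_abs.trans (setIntegral_le_integral (hi.sub integrable_gauss).abs
      (Eventually.of_forall fun u => abs_nonneg _))
  rw [e1, e2]
  calc |(∫ u in Set.Iio y, stepDensity n u) - ∫ t in Set.Iic x, gauss t|
      = |((∫ u in Set.Iio y, stepDensity n u) - ∫ t in Set.Iio y, gauss t) +
          ∫ t in Set.Ioo x y, gauss t| := by rw [e3]; congr 1; ring
    _ ≤ _ := (abs_add_le _ _).trans (add_le_add h5 h4)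

end Sextet

end

theorem mainTheorem3 :
    Sextet.AsymptoticallyNormalCLT Sextet.pyreneNumber ∧
    Sextet.AsymptoticallyNormalLLT Sextet.pyreneNumber ∧
    (∀ n : ℕ, Sextet.seqMean Sextet.pyreneNumber n = (n : ℝ)) ∧
    (∀ n : ℕ, Sextet.seqVariance Sextet.pyreneNumber n =
      1 / 2 * ∑ k ∈ Finset.Icc 1 n,
        1 / (1 + Real.cos ((k : ℝ) * Real.pi / (2 * (n : ℝ) + 2)) ^ 2)) ∧
    Asymptotics.IsEquivalent atTop (Sextet.seqVariance Sextet.pyreneNumber)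
      (fun n : ℕ => √2 / 4 * (n : ℝ)) := by
  refine ⟨Sextet.asymptoticallyNormalCLT_pyreneNumber, Sextet.asymptoticallyNormalLLT_pyreneNumber,
    Sextet.seqMean_pyreneNumber,
    fun n => (Sextet.seqVariance_pyreneNumber n).trans (Sextet.var_eq n), ?_⟩
  rw [funext Sextet.seqVariance_pyreneNumber]
  exact Sextet.var_isEquivalent
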